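/- Notation and conventions. For $\beta\in\mathbb N^n$ put $|\beta|=\beta_1+\dots+\beta_n$ and $z^\beta=z_1^{\beta_1}\cdots z_n^{\beta_n}$; let $\mathbb D^n(0,\rho)=\{z\in\mathbb C^n: |z_1|<\rho,\dots,|z_n|<\rho\}$ and $\mathbb D^n=\mathbb D^n(0,1)$. The monomials are enumerated as $e_k(z)=z^{\alpha(k)}$, $k\ge 0$, where $k<j$ if and only if $|\alpha(k)|<|\alpha(j)|$, or $|\alpha(k)|=|\alpha(j)|$ and $\alpha_s(k)>\alpha_s(j)$ for the smallest $s$ with $\alpha_s(k)\ne\alpha_s(j)$; thus $e_0=1$. For a holomorphic vector field $G$ near $0\in\mathbb C^n$, the Koopman generator is $L_Gf=G\cdot\nabla f$, and $\langle L_Ge_k,e_j\rangle$ denotes the coefficient of $z^{\alpha(j)}$ in the Taylor series of $L_Ge_k$ at $0$ (the Hardy-space inner product when $L_Ge_k\in\mathbb H^2(\mathbb D^n)$). $JG(0)$ is the Jacobian matrix of $G$ at $0$. A commutation law is a map $\sigma:[0,\infty)\to\{1,\dots,m\}$ with finitely many discontinuities on every bounded interval. A trajectory of the switched system $\{\dot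 z=F^{(i)}(z)\}_{i=1}^m$ on $\mathbb D^n$ for $\sigma$ is a continuous $z:[0,\infty)\to\mathbb D^n$ with $\dot z(t)=F^{(\sigma(t))}(z(t))$ at every $t>0$ at which $\sigma$ is continuous. If $F^{(i)}(0)=0$ for all $i$, the switched system is GUAS (globally uniformly asymptotically stable) on $D\subseteq\mathbb D^n$ if (a) for every $\epsilon>0$ there is $\delta>0$ such that for all $\sigma$ and all trajectories with $\|z(0)\|\le\delta$ one has $\|z(t)\|\le\epsilon$ for all $t>0$ and $\lim_{t\to\infty}z(t)=0$; and (b) for all $\sigma$ and all trajectories with $z(0)\in D$, $\lim_{t\to\infty}z(t)=0$. Statement. Let $F^{(1)},\dots,F^{(m)}$ be vector fields on $\mathbb D^n$ whose components are given on $\mathbb D^n$ by power series with absolutely summable coefficients: $F^{(i)}_l(z)=\sum_{k}a^{(i)}_{l,k}z^{\alpha(k)}$ with $\sum_k|a^{(i)}_{l,k}|<\infty$. Assume that: 1. each $F^{(i)}$ generates a holomorphic flow $\varphi^{(i)}_t:\mathbb D^n\to\mathbb D^n$, $t\ge0$; $F^{(i)}(0)=0$; all eigenvalues of $JF^{(i)}(0)$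 have negative real part; and $0$ is globally asymptotically stable on $\mathbb D^n$ for each $\varphi^{(i)}$ (it is stable, and $\varphi_t^{(i)}(z)\to0$ as $t\to\infty$ for every $z\in\mathbb D^n$); 2. the Lie algebra of matrices generated by $JF^{(1)}(0),\dots,JF^{(m)}(0)$ is solvable; $P$ is an invertible complex matrix such that all $P^{-1}JF^{(i)}(0)P$ are upper triangular, normalized by $\|P^{-1}\|_\infty=1$ (operator norm for the maximum norm of $\mathbb C^n$); and $\widehat F^{(i)}(\widehat z)=P^{-1}F^{(i)}(P\widehat z)$, a holomorphic vector field near $0$; 3. $\rho\in\,]0,1]$ and $\varphi^{(i)}_t(\mathbb D^n(0,\rho))\subseteq\mathbb D^n(0,\rho)$ for all $i$ and $t\ge 0$. Suppose that there are $\xi,\kappa\in\,]0,1[$ with $\xi+\kappa<1$ such that, for all $i$ and all $q<r$ in $\{1,\dots,n\}$, $$\left|[J\widehat F^{(i)}(0)]_{qr}\right|^2<\left(\frac{2\xi}{n^2-n}\right)^2\left|\Re[J\widehat F^{(i)}(0)]_{rr}\right|\left|\Re[J\widehat F^{(i)}(0)]_{qq}\right|,$$ $$\left|[J\widehat F^{(i)}(0)]_{qr}\right|<\frac{2\xi}{n^2-n}\left|\Re[J\widehat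 F^{(i)}(0)]_{qq}\right|,$$ and $$\max_{i=1,\dots,m}\ \limsup_{j\to\infty}\ \max_{\substack{1\le k\le j-1\\ \langle L_{\widehat F^{(i)}}e_k,e_j\rangle\ne0}}\ \frac{\sum_{l=1}^\infty\left|\langle L_{\widehat F^{(i)}}e_l,e_j\rangle\right|\ \sum_{l=1}^\infty\left|\langle L_{\widehat F^{(i)}}e_k,e_l\rangle\right|}{\kappa^2\left|\Re\langle L_{\widehat F^{(i)}}e_j,e_j\rangle\right|\left|\Re\langle L_{\widehat F^{(i)}}e_k,e_k\rangle\right|}<\frac1{\rho^2},$$ where the sums take values in $[0,\infty]$ and a maximum over the empty set is $0$. Then the switched system $\{\dot z=F^{(i)}(z)\}_{i=1}^m$ is GUAS on $\mathbb D^n(0,\rho)$. -/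

import Mathlib

/-!
In the coordinates `w = P⁻¹ z` every field is triangular at `0`, so its Koopman matrix is block
triangular by degree and has the diagonal entries `∑ β_l T_ll`, with real parts `-D_β < 0`. A common
Lyapunov function for all fields is `V w = ∑ ε_{|β|} |w^β|²`, with weights `ε` that depend only on
the degree. Along a field the diagonal contributes `-2 Y` to the derivative of `V`, where
`Y = ∑ ε_{|β|} D_β |w^β|²`. The other entries between monomials of the same degree come from the
part of the Jacobian matrix above the diagonal and cost at most `2 ξ Y` by the inequality of
arithmetic and geometric means. The entries that raise the degree cost at most `2 κ Y` by a weighted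
Schur test, as soon as `ε_{|β|} R_β C_γ ≤ κ² D_β D_γ ε_{|γ|}` holds for the absolute row sums `R`
and column sums `C` whenever the entry `(β, γ)` is nonzero. The limit superior condition is exactly
what allows such weights to grow no faster than `ρ^(-2k)`, so that `V` converges on the polydisk of
radius `ρ`. Since `ξ + κ < 1`, `V` then decays exponentially along every trajectory. It is
differentiated termwise as a power series in the squared moduli `|w_l|²`.
-/

open Filter Topology Set
open scoped ENNReal NNReal

noncomputable section

namespace SwitchedKoopman

/-! ### Switched systems and stability -/

section Switched

variable {m : ℕ} {E : Type*} [NormedAddCommGroup E] [NormedSpace ℝ E]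

/-- A commutation law: a map `σ : [0, ∞) → {1, …, m}` (the values at negative times are never used)
with finitely many discontinuities on every bounded time interval. As `Fin m` is discrete, `σ` is
constant between two consecutive discontinuities. -/
def IsCommutationLaw (σ : ℝ → Fin m) : Prop :=
  ∀ T : ℝ, {t : ℝ | 0 < t ∧ t ≤ T ∧ ¬ ContinuousAt σ t}.Finite

/-- `x` is a solution on `[0, ∞)` of the switched system `ẋ = F^{(σ)}(x)` with state space `X`:
it is continuous, stays in `X`, and satisfies the differential equation off the switching times. -/
structure IsTrajectory (F : Fin m → E → E) (X : Set E) (σ : ℝ → Fin m) (x : ℝ → E) : Prop where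
  continuousOn : ContinuousOn x (Ici 0)
  mem : ∀ t, 0 ≤ t → x t ∈ X
  hasDerivAt : ∀ t, 0 < t → ContinuousAt σ t → HasDerivAt x (F (σ t) (x t)) t

/-- Uniform asymptotic stability of the common equilibrium `xe` of a switched system on `X`. -/
def IsUAS (F : Fin m → E → E) (X : Set E) (xe : E) : Prop :=
  (∀ i, F i xe = 0) ∧
  ∀ ε : ℝ, 0 < ε → ∃ δ : ℝ, 0 < δ ∧
    (∀ σ x, IsCommutationLaw σ → IsTrajectory F X σ x → ‖x 0 - xe‖ ≤ δ →
      ∀ t, 0 < t → ‖x t - xe‖ ≤ ε) ∧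
    (∀ σ x, IsCommutationLaw σ → IsTrajectory F X σ x → ‖x 0 - xe‖ ≤ δ →
      Tendsto x atTop (𝓝 xe))

/-- Global uniform asymptotic stability on `D` of the common equilibrium `xe` of a switched
system on `X`. -/
def IsGUAS (F : Fin m → E → E) (X : Set E) (xe : E) (D : Set E) : Prop :=
  IsUAS F X xe ∧
  ∀ σ x, IsCommutationLaw σ → IsTrajectory F X σ x → x 0 ∈ D → Tendsto x atTop (𝓝 xe)

/-- The point `xe` is a globally asymptotically stable equilibrium, on the state space `X`, of the
single (non-switched) system with flow `φ`. -/
def IsGloballyAsymptoticallyStable (φ : ℝ → E → E) (X : Set E) (xe : E) : Prop :=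
  (∀ ε : ℝ, 0 < ε → ∃ δ : ℝ, 0 < δ ∧
    ∀ z ∈ X, ‖z - xe‖ ≤ δ → ∀ t, 0 ≤ t → ‖φ t z - xe‖ ≤ ε) ∧
  ∀ z ∈ X, Tendsto (fun t => φ t z) atTop (𝓝 xe)

end Switched

/-! ### Vector fields on the polydisk -/

variable {n : ℕ}

/-- The open polydisk of `ℂⁿ` centred at `0` with radius `ρ`. -/
def polydisk (n : ℕ) (ρ : ℝ) : Set (Fin n → ℂ) := {z | ∀ l, ‖z l‖ < ρ}

/-- `φ` is the forward flow on `X` of the vector field `F`, and it is holomorphic. -/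
structure IsHolomorphicFlow (F : (Fin n → ℂ) → (Fin n → ℂ)) (X : Set (Fin n → ℂ))
    (φ : ℝ → (Fin n → ℂ) → (Fin n → ℂ)) : Prop where
  map_zero : ∀ z ∈ X, φ 0 z = z
  mapsTo : ∀ t, 0 ≤ t → MapsTo (φ t) X X
  hasDerivWithinAt : ∀ z ∈ X, ∀ t, 0 ≤ t →
    HasDerivWithinAt (fun s => φ s z) (F (φ t z)) (Ici 0) t
  differentiableOn : ∀ t, 0 ≤ t → DifferentiableOn ℂ (φ t) X

/-- The Jacobian matrix of `F` at `z`. -/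
def jacobian (F : (Fin n → ℂ) → (Fin n → ℂ)) (z : Fin n → ℂ) : Matrix (Fin n) (Fin n) ℂ :=
  LinearMap.toMatrix' (fderiv ℂ F z : (Fin n → ℂ) →ₗ[ℂ] (Fin n → ℂ))

/-- `0` is an equilibrium of `F` whose Jacobian matrix has only eigenvalues with negative
real part. -/
def IsHyperbolicStableAtZero (F : (Fin n → ℂ) → (Fin n → ℂ)) : Prop :=
  F 0 = 0 ∧ ∀ μ ∈ spectrum ℂ (jacobian F 0), μ.re < 0

section LieSpan

attribute [local instance] LieRing.ofAssociativeRing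

/-- The complex Lie algebra generated by the set `S` of matrices, with bracket `AB - BA`, is
solvable. -/
def HasSolvableLieSpan (S : Set (Matrix (Fin n) (Fin n) ℂ)) : Prop :=
  LieAlgebra.IsSolvable (LieSubalgebra.lieSpan ℂ (Matrix (Fin n) (Fin n) ℂ) S)

end LieSpan

/-- The vector field in the coordinates `w = P⁻¹ z`, i.e. `w ↦ P⁻¹ F(P w)`. -/
def changeCoord (P : Matrix (Fin n) (Fin n) ℂ) (F : (Fin n → ℂ) → (Fin n → ℂ)) :
    (Fin n → ℂ) → (Fin n → ℂ) :=
  fun w => P⁻¹.mulVec (F (P.mulVec w))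

/-- The operator norm of a matrix for the maximum norm of `ℂⁿ` (largest absolute row sum). -/
def infNorm (A : Matrix (Fin n) (Fin n) ℂ) : ℝ≥0 :=
  Finset.univ.sup fun i => ∑ j, ‖A i j‖₊

/-! ### Monomials and Taylor coefficients -/

/-- The monomial `z ↦ z^β`. -/
def mono (β : Fin n → ℕ) : (Fin n → ℂ) → ℂ := fun z => ∏ l, z l ^ β l

/-- The function `f` is given on the unit polydisk by a power series with absolutely summable
coefficients. -/
def HasSummableTaylor (f : (Fin n → ℂ) → ℂ) : Prop :=
  ∃ a : (Fin n → ℕ) → ℂ, Summable (fun β => ‖a β‖) ∧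
    ∀ z ∈ polydisk n 1, HasSum (fun β => a β * mono β z) (f z)

/-- The strict order used to enumerate the monomials: by total degree first; among monomials of
the same degree, the one with the larger exponent at the first difference comes first. -/
def MonoLT (β γ : Fin n → ℕ) : Prop :=
  ∑ l, β l < ∑ l, γ l ∨
    (∑ l, β l = ∑ l, γ l ∧ ∃ j, (∀ i, i < j → β i = γ i) ∧ γ j < β j)

/-- The partial derivative `∂f/∂z_l`. -/
def partialDeriv (l : Fin n) (f : (Fin n → ℂ) → ℂ) : (Fin n → ℂ) → ℂ :=
  fun z => fderiv ℂ f z (Pi.single l 1)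

/-- The mixed partial derivative `∂^β f`. -/
def multiDeriv (β : Fin n → ℕ) (f : (Fin n → ℂ) → ℂ) : (Fin n → ℂ) → ℂ :=
  (List.finRange n).foldr (fun l g => (partialDeriv l)^[β l] g) f

/-- The coefficient `∂^β f(0) / β!` of `z^β` in the Taylor series at `0` of a function that is
holomorphic near `0`. If `f` lies in the Hardy space of the unit polydisk, it is the inner product
of `f` with the monomial `z^β`. -/
def taylorCoeff (f : (Fin n → ℂ) → ℂ) (β : Fin n → ℕ) : ℂ :=
  multiDeriv β f 0 / ((∏ l, (β l).factorial : ℕ) : ℂ)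

/-! ### The Koopman generator and its matrix -/

/-- The Koopman generator `L_F f = F · ∇f`. -/
def koopmanGenerator (F : (Fin n → ℂ) → (Fin n → ℂ)) (f : (Fin n → ℂ) → ℂ) :
    (Fin n → ℂ) → ℂ :=
  fun z => fderiv ℂ f z (F z)

/-- The entry `⟨L_F z^β, z^γ⟩` (row `β`, column `γ`) of the Koopman matrix. -/
def koopmanEntry (F : (Fin n → ℂ) → (Fin n → ℂ)) (β γ : Fin n → ℕ) : ℂ :=
  taylorCoeff (koopmanGenerator F (mono β)) γ

/-- The absolute sum of row `β` of the Koopman matrix, over the non-constant monomials; it may be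
infinite. -/
def koopmanRowSum (F : (Fin n → ℂ) → (Fin n → ℂ)) (β : Fin n → ℕ) : ℝ≥0∞ :=
  ∑' γ : {γ : Fin n → ℕ // γ ≠ 0}, ‖koopmanEntry F β γ‖ₑ

/-- The absolute sum of column `γ` of the Koopman matrix, over the non-constant monomials. -/
def koopmanColSum (F : (Fin n → ℂ) → (Fin n → ℂ)) (γ : Fin n → ℕ) : ℝ≥0∞ :=
  ∑' β : {β : Fin n → ℕ // β ≠ 0}, ‖koopmanEntry F β γ‖ₑ

/-- The quotient of the product (absolute sum of column `γ`) · (absolute sum of row `β`) by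
`κ² |Re ⟨L_F z^γ, z^γ⟩| |Re ⟨L_F z^β, z^β⟩|`. -/
def koopmanRatio (κ : ℝ) (F : (Fin n → ℂ) → (Fin n → ℂ)) (β γ : Fin n → ℕ) : ℝ≥0∞ :=
  koopmanColSum F γ * koopmanRowSum F β /
    ENNReal.ofReal (κ ^ 2 * |(koopmanEntry F γ γ).re| * |(koopmanEntry F β β).re|)

/-- The limit superior over the monomials `z^γ` of the maximum of `koopmanRatio κ F β γ` over the
non-constant `z^β` preceding `z^γ` with `⟨L_F z^β, z^γ⟩ ≠ 0` (the maximum is `0` if there is none).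
A limit superior along an enumeration by `ℕ` is one along the cofinite filter. -/
def koopmanLimsup (κ : ℝ) (F : (Fin n → ℂ) → (Fin n → ℂ)) : ℝ≥0∞ :=
  limsup (fun γ : Fin n → ℕ =>
    ⨆ (β : Fin n → ℕ) (_ : β ≠ 0) (_ : MonoLT β γ) (_ : koopmanEntry F β γ ≠ 0),
      koopmanRatio κ F β γ) cofinite

end SwitchedKoopman

end

open SwitchedKoopman

open scoped ComplexConjugate

namespace SwitchedKoopman

variable {n : ℕ}

/-! ### Multi-indices and monomials -/

/-- The total degree `|β|` of a multi-index. -/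
abbrev deg (β : Fin n → ℕ) : ℕ := ∑ l, β l

theorem deg_add (β γ : Fin n → ℕ) : deg (β + γ) = deg β + deg γ :=
  Finset.sum_add_distrib

@[simp] theorem deg_single (l : Fin n) : deg (Pi.single l 1) = 1 := by
  simp [deg]

theorem deg_eq_zero {β : Fin n → ℕ} : deg β = 0 ↔ β = 0 := by
  simp [deg, funext_iff]

theorem sub_single_add_single {β : Fin n → ℕ} {l : Fin n} (h : β l ≠ 0) :
    β - Pi.single l 1 + Pi.single l 1 = β := by
  funext j
  by_cases hj : j = l
  · subst hj
    simp only [Pi.add_apply, Pi.sub_apply, Pi.single_eq_same]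
    omega
  · simp [hj]

theorem deg_sub_single_add_one {β : Fin n → ℕ} {l : Fin n} (hl : β l ≠ 0) :
    deg (β - Pi.single l 1) + 1 = deg β := by
  conv_rhs => rw [← sub_single_add_single hl, deg_add, deg_single]

theorem deg_eq_one {β : Fin n → ℕ} : deg β = 1 ↔ ∃ r, β = Pi.single r 1 := by
  refine ⟨fun h => ?_, by rintro ⟨r, rfl⟩; exact deg_single r⟩
  have hne : β ≠ 0 := fun h0 => by simp [deg_eq_zero.2 h0] at h
  obtain ⟨r, hr⟩ := Function.ne_iff.1 hne
  have hpred : β - Pi.single r 1 = 0 := by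
    rw [← deg_eq_zero]
    have := deg_sub_single_add_one hr
    omega
  exact ⟨r, by rw [← sub_single_add_single hr, hpred, zero_add]⟩

theorem finite_deg_le (d : ℕ) : {β : Fin n → ℕ | deg β ≤ d}.Finite :=
  (Set.finite_Iic (fun _ => d : Fin n → ℕ)).subset fun β hβ l =>
    (Finset.single_le_sum (f := β) (fun _ _ => zero_le) (Finset.mem_univ l)).trans hβ

theorem polydisk_eq_ball {s : ℝ} (hs : 0 < s) : polydisk n s = Metric.ball 0 s := by
  ext z
  simp [polydisk, pi_norm_lt_iff hs]

@[simp] theorem mono_zero (w : Fin n → ℂ) : mono 0 w = 1 := by simp [mono]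

@[simp] theorem mono_single (l : Fin n) (w : Fin n → ℂ) : mono (Pi.single l 1) w = w l := by
  rw [mono, Finset.prod_eq_single l] <;> simp +contextual

theorem mono_add (β γ : Fin n → ℕ) (w : Fin n → ℂ) : mono (β + γ) w = mono β w * mono γ w := by
  simp [mono, pow_add, Finset.prod_mul_distrib]

theorem mono_const (β : Fin n → ℕ) (t : ℂ) : mono β (fun _ => t) = t ^ deg β :=
  Finset.prod_pow_eq_pow_sum _ _ _

theorem mono_apply_zero {β : Fin n → ℕ} (hβ : β ≠ 0) : mono β 0 = 0 := by
  obtain ⟨l, hl⟩ := Function.ne_iff.1 hβ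
  exact Finset.prod_eq_zero (Finset.mem_univ l) (zero_pow hl)

theorem mono_sub_single_mul {β : Fin n → ℕ} {l : Fin n} (hl : β l ≠ 0) (w : Fin n → ℂ) :
    mono (β - Pi.single l 1) w * w l = mono β w := by
  conv_rhs => rw [← sub_single_add_single hl, mono_add, mono_single]

theorem norm_mono (β : Fin n → ℕ) (w : Fin n → ℂ) : ‖mono β w‖ = ∏ l, ‖w l‖ ^ β l := by
  simp [mono, norm_prod]

theorem norm_mono_le (β : Fin n → ℕ) {w : Fin n → ℂ} {s : ℝ} (hw : ‖w‖ ≤ s) :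
    ‖mono β w‖ ≤ s ^ deg β := by
  rw [norm_mono, ← Finset.prod_pow_eq_pow_sum]
  gcongr with l
  exact (norm_le_pi_norm w l).trans hw

/-- The derivative of the monomial `z^β` at `w`. -/
noncomputable def monoDeriv (β : Fin n → ℕ) (w : Fin n → ℂ) : (Fin n → ℂ) →L[ℂ] ℂ :=
  ∑ l, ((β l : ℂ) * mono (β - Pi.single l 1) w) •
    (ContinuousLinearMap.proj l : (Fin n → ℂ) →L[ℂ] ℂ)

theorem monoDeriv_apply (β : Fin n → ℕ) (w v : Fin n → ℂ) :
    monoDeriv β w v = ∑ l, (β l : ℂ) * mono (β - Pi.single l 1) w * v l := by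
  simp [monoDeriv]

theorem natCast_mul_mono_sub_single (β : Fin n → ℕ) (l : Fin n) (w : Fin n → ℂ) :
    (β l : ℂ) * mono (β - Pi.single l 1) w =
      (∏ j ∈ Finset.univ.erase l, w j ^ β j) * (β l * w l ^ (β l - 1)) := by
  have hprod : ∏ j ∈ Finset.univ.erase l, w j ^ (β - Pi.single l 1 : Fin n → ℕ) j =
      ∏ j ∈ Finset.univ.erase l, w j ^ β j :=
    Finset.prod_congr rfl fun j hj => by simp [Finset.ne_of_mem_erase hj]
  rw [mono, ← Finset.mul_prod_erase _ _ (Finset.mem_univ l), hprod, Pi.sub_apply,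
    Pi.single_eq_same]
  ring

theorem hasFDerivAt_mono (β : Fin n → ℕ) (w : Fin n → ℂ) :
    HasFDerivAt (mono β) (monoDeriv β w) w := by
  have hpow (l : Fin n) : HasFDerivAt (fun z : Fin n → ℂ => z l ^ β l) _ w :=
    ((ContinuousLinearMap.proj l : (Fin n → ℂ) →L[ℂ] ℂ).hasFDerivAt (x := w)).pow (β l)
  refine (HasFDerivAt.finsetProd fun l _ => hpow l).congr_fderiv ?_
  refine Finset.sum_congr rfl fun l _ => ?_
  rw [smul_smul, natCast_mul_mono_sub_single]
  simp

theorem norm_monoDeriv_le (β : Fin n → ℕ) {w : Fin n → ℂ} {s : ℝ} (hw : ‖w‖ ≤ s) :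
    ‖monoDeriv β w‖ ≤ deg β * s ^ (deg β - 1) := by
  have hs : 0 ≤ s := (norm_nonneg _).trans hw
  refine ContinuousLinearMap.opNorm_le_bound _ (by positivity) fun v => ?_
  rw [monoDeriv_apply, deg, Nat.cast_sum, Finset.sum_mul, Finset.sum_mul]
  refine norm_sum_le_of_le _ fun l _ => ?_
  rw [norm_mul, norm_mul, Complex.norm_natCast]
  by_cases hl : β l = 0
  · simp [hl]
  have hmono : ‖mono (β - Pi.single l 1) w‖ ≤ s ^ (deg β - 1) := by
    rw [← deg_sub_single_add_one hl, Nat.add_sub_cancel]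
    exact norm_mono_le _ hw
  gcongr
  exact norm_le_pi_norm v l

theorem natCast_mul_pow_mul_sub_le {R : Type*} [CommRing R] [PartialOrder R] [IsOrderedRing R]
    {x y : R} (hx : 0 ≤ x) (hxy : x ≤ y) (k : ℕ) : k * x ^ (k - 1) * (y - x) ≤ y ^ k := by
  have := hx.trans hxy
  have hsum : (k : R) * x ^ (k - 1) ≤ ∑ i ∈ Finset.range k, y ^ i * x ^ (k - 1 - i) := by
    rw [← nsmul_eq_mul]
    refine (Finset.card_nsmul_le_sum _ _ _ fun i hi => ?_).trans' (by rw [Finset.card_range])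
    rw [← Nat.add_sub_of_le (Nat.le_sub_one_of_lt (Finset.mem_range.1 hi)), pow_add,
      Nat.add_sub_cancel_left]
    gcongr
  calc k * x ^ (k - 1) * (y - x)
      ≤ (∑ i ∈ Finset.range k, y ^ i * x ^ (k - 1 - i)) * (y - x) :=
        mul_le_mul_of_nonneg_right hsum (sub_nonneg.2 hxy)
    _ = y ^ k - x ^ k := geom_sum₂_mul y x k
    _ ≤ y ^ k := sub_le_self _ (pow_nonneg hx k)

/-! ### Monomial series -/

/-- `f` is the sum of the power series with coefficients `a` on the open polydisk of radius `s`,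
written as a ball for the maximum norm. -/
def HasMonoSeries (s : ℝ) (f : (Fin n → ℂ) → ℂ) (a : (Fin n → ℕ) → ℂ) : Prop :=
  ∀ w ∈ Metric.ball (0 : Fin n → ℂ) s, HasSum (fun β => a β * mono β w) (f w)

theorem hasMonoSeries_one (s : ℝ) : HasMonoSeries s (fun _ : Fin n → ℂ => 1) (Pi.single 0 1) :=
  fun w _ => by
    convert hasSum_single (0 : Fin n → ℕ) fun β hβ => ?_ using 1
    · simp
    · simp [hβ]

namespace HasMonoSeries

variable {s t : ℝ} {f : (Fin n → ℂ) → ℂ} {a : (Fin n → ℕ) → ℂ} {w : Fin n → ℂ}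

theorem congr {g : (Fin n → ℂ) → ℂ} (h : HasMonoSeries s f a)
    (hfg : ∀ w ∈ Metric.ball (0 : Fin n → ℂ) s, f w = g w) : HasMonoSeries s g a :=
  fun w hw => hfg w hw ▸ h w hw

theorem of_le (h : HasMonoSeries s f a) (hts : t ≤ s) : HasMonoSeries t f a :=
  fun w hw => h w (Metric.ball_subset_ball hts hw)

theorem const_mul (h : HasMonoSeries s f a) (c : ℂ) :
    HasMonoSeries s (fun w => c * f w) fun β => c * a β := fun w hw => by
  simpa only [mul_assoc] using (h w hw).mul_left c

theorem sum {ι : Type*} {f : ι → (Fin n → ℂ) → ℂ} {a : ι → (Fin n → ℕ) → ℂ} (S : Finset ι)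
    (h : ∀ k ∈ S, HasMonoSeries s (f k) (a k)) :
    HasMonoSeries s (fun w => ∑ k ∈ S, f k w) fun β => ∑ k ∈ S, a k β := fun w hw => by
  simpa only [Finset.sum_mul] using hasSum_sum fun k hk => h k hk w hw

theorem apply_zero (h : HasMonoSeries s f a) (hs : 0 < s) : f 0 = a 0 := by
  refine (h 0 (Metric.mem_ball_self hs)).unique ?_
  convert hasSum_single (0 : Fin n → ℕ) fun β hβ => ?_ using 1
  · simp
  · rw [mono_apply_zero hβ, mul_zero]

theorem summable_norm_mul_pow (h : HasMonoSeries s f a) (ht : 0 ≤ t) (hts : t < s) :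
    Summable fun β => ‖a β‖ * t ^ deg β := by
  have hw : (fun _ => (t : ℂ)) ∈ Metric.ball (0 : Fin n → ℂ) s := by
    rw [mem_ball_zero_iff, pi_norm_lt_iff (ht.trans_lt hts)]
    intro _
    rwa [Complex.norm_real, Real.norm_of_nonneg ht]
  refine (h _ hw).summable.norm.congr fun β => ?_
  rw [mono_const, norm_mul, norm_pow, Complex.norm_real, Real.norm_of_nonneg ht]

theorem summable_norm_mul_deg_mul_pow (h : HasMonoSeries s f a) (ht : 0 ≤ t) (hts : t < s) :
    Summable fun β => ‖a β‖ * (deg β * t ^ (deg β - 1)) := by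
  obtain ⟨r, htr, hrs⟩ := exists_between hts
  refine Summable.of_nonneg_of_le (fun β => by positivity) (fun β => ?_)
    ((h.summable_norm_mul_pow (ht.trans htr.le) hrs).mul_right (r - t)⁻¹)
  rw [mul_assoc, ← div_eq_mul_inv]
  gcongr
  rw [le_div_iff₀ (sub_pos.2 htr)]
  exact natCast_mul_pow_mul_sub_le ht htr.le _

theorem norm_smul_monoDeriv_le (a : (Fin n → ℕ) → ℂ) (β : Fin n → ℕ)
    (hw : w ∈ Metric.ball (0 : Fin n → ℂ) t) :
    ‖a β • monoDeriv β w‖ ≤ ‖a β‖ * (deg β * t ^ (deg β - 1)) := by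
  rw [norm_smul]
  gcongr
  exact norm_monoDeriv_le β (mem_ball_zero_iff.1 hw).le

theorem hasFDerivAt (h : HasMonoSeries s f a) (hw : w ∈ Metric.ball (0 : Fin n → ℂ) s) :
    HasFDerivAt f (∑' β, a β • monoDeriv β w) w := by
  obtain ⟨t, hwt, hts⟩ := exists_between (mem_ball_zero_iff.1 hw)
  have ht : 0 < t := (norm_nonneg w).trans_lt hwt
  have hwt : w ∈ Metric.ball (0 : Fin n → ℂ) t := mem_ball_zero_iff.2 hwt
  have hderiv := hasFDerivAt_tsum_of_isPreconnected
    (h.summable_norm_mul_deg_mul_pow ht.le hts) Metric.isOpen_ball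
    (convex_ball (0 : Fin n → ℂ) t).isPreconnected
    (fun β w _ => (hasFDerivAt_mono β w).const_mul (a β))
    (fun β w hw => norm_smul_monoDeriv_le a β hw) hwt (h w hw).summable hwt
  refine hderiv.congr_of_eventuallyEq ?_
  filter_upwards [Metric.isOpen_ball.mem_nhds hw] with z hz
  exact (h z hz).tsum_eq.symm

theorem differentiableAt (h : HasMonoSeries s f a) (hw : w ∈ Metric.ball (0 : Fin n → ℂ) s) :
    DifferentiableAt ℂ f w :=
  (h.hasFDerivAt hw).differentiableAt

theorem hasSum_fderiv (h : HasMonoSeries s f a) (hw : w ∈ Metric.ball (0 : Fin n → ℂ) s) :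
    HasSum (fun β => a β • monoDeriv β w) (fderiv ℂ f w) := by
  obtain ⟨t, hwt, hts⟩ := exists_between (mem_ball_zero_iff.1 hw)
  have ht : 0 ≤ t := (norm_nonneg w).trans hwt.le
  rw [(h.hasFDerivAt hw).fderiv]
  exact (Summable.of_norm_bounded (h.summable_norm_mul_deg_mul_pow ht hts) fun β =>
    norm_smul_monoDeriv_le a β (mem_ball_zero_iff.2 hwt)).hasSum

theorem hasSum_fderiv_apply (h : HasMonoSeries s f a) (hw : w ∈ Metric.ball (0 : Fin n → ℂ) s)
    (v : Fin n → ℂ) : HasSum (fun β => a β * monoDeriv β w v) (fderiv ℂ f w v) := by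
  simpa using (h.hasSum_fderiv hw).mapL (ContinuousLinearMap.apply ℂ ℂ v)

theorem exists_lipschitzOnWith (h : HasMonoSeries s f a) (hts : t < s) :
    ∃ K : ℝ≥0, LipschitzOnWith K f (Metric.ball 0 t) := by
  rcases le_or_gt t 0 with ht | ht
  · exact ⟨0, by simp [Metric.ball_eq_empty.2 ht]⟩
  have hball : ∀ w ∈ Metric.ball (0 : Fin n → ℂ) t, w ∈ Metric.ball (0 : Fin n → ℂ) s :=
    fun w hw => Metric.ball_subset_ball hts.le hw
  refine ⟨(∑' β, ‖a β‖ * (deg β * t ^ (deg β - 1))).toNNReal,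
    (convex_ball (0 : Fin n → ℂ) t).lipschitzOnWith_of_nnnorm_fderiv_le (𝕜 := ℂ)
      (fun w hw => h.differentiableAt (hball w hw)) fun w hw => ?_⟩
  rw [← norm_toNNReal, ← (h.hasSum_fderiv (hball w hw)).tsum_eq]
  exact Real.toNNReal_mono <| tsum_of_norm_bounded
    (h.summable_norm_mul_deg_mul_pow ht.le hts).hasSum fun β => norm_smul_monoDeriv_le a β hw

end HasMonoSeries

/-! ### Taylor coefficients -/

/-- The multi-index factorial `β!`. -/
def multiFactorial (β : Fin n → ℕ) : ℕ := ∏ l, (β l).factorial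

theorem multiFactorial_ne_zero (β : Fin n → ℕ) : (multiFactorial β : ℂ) ≠ 0 :=
  Nat.cast_ne_zero.2 (Finset.prod_pos fun _ _ => Nat.factorial_pos _).ne'

theorem multiFactorial_add_single (β : Fin n → ℕ) (l : Fin n) :
    multiFactorial (β + Pi.single l 1) = (β l + 1) * multiFactorial β := by
  rw [multiFactorial, multiFactorial, ← Finset.mul_prod_erase _ _ (Finset.mem_univ l),
    ← Finset.mul_prod_erase Finset.univ (fun j => (β j).factorial) (Finset.mem_univ l), ← mul_assoc]
  congr 1
  · simp [Nat.factorial_succ]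
  · exact Finset.prod_congr rfl fun j hj => by simp [Finset.ne_of_mem_erase hj]

theorem monoDeriv_single (β : Fin n → ℕ) (w : Fin n → ℂ) (l : Fin n) :
    monoDeriv β w (Pi.single l 1) = β l * mono (β - Pi.single l 1) w := by
  rw [monoDeriv_apply, Finset.sum_eq_single l] <;> simp +contextual

namespace HasMonoSeries

variable {s : ℝ} {f : (Fin n → ℂ) → ℂ} {a c : (Fin n → ℕ) → ℂ}

theorem partialDeriv (h : HasMonoSeries s f a) (l : Fin n) :
    HasMonoSeries s (partialDeriv l f) fun β => ((β l : ℂ) + 1) * a (β + Pi.single l 1) := by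
  intro w hw
  have hsum := h.hasSum_fderiv_apply hw (Pi.single l 1)
  simp only [monoDeriv_single] at hsum
  rw [← (add_left_injective (Pi.single l 1 : Fin n → ℕ)).hasSum_iff] at hsum
  · refine hsum.congr_fun fun β => ?_
    simp only [Function.comp, Pi.add_apply, Pi.single_eq_same, add_tsub_cancel_right]
    push_cast
    ring
  · intro β hβ
    have hβl : β l = 0 := by
      by_contra hne
      exact hβ ⟨β - Pi.single l 1, sub_single_add_single hne⟩
    rw [hβl, Nat.cast_zero, zero_mul, mul_zero]

theorem iterate_partialDeriv (h : HasMonoSeries s f fun β => c β / multiFactorial β)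
    (l : Fin n) (k : ℕ) :
    HasMonoSeries s ((SwitchedKoopman.partialDeriv l)^[k] f)
      fun β => c (β + k • Pi.single l 1) / multiFactorial β := by
  induction k with
  | zero => simpa using h
  | succ k ih =>
    rw [Function.iterate_succ', Function.comp]
    convert ih.partialDeriv l using 2 with β
    have hne : (β l : ℂ) + 1 ≠ 0 := Nat.cast_add_one_ne_zero _
    rw [multiFactorial_add_single, add_smul, one_smul, add_assoc, add_comm (k • _)]
    push_cast
    field_simp

theorem multiDeriv (h : HasMonoSeries s f fun β => c β / multiFactorial β) (β : Fin n → ℕ) :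
    HasMonoSeries s (multiDeriv β f) fun γ => c (γ + β) / multiFactorial γ := by
  have hfold (L : List (Fin n)) :
      HasMonoSeries s (L.foldr (fun l g => (SwitchedKoopman.partialDeriv l)^[β l] g) f)
        fun γ => c (γ + (L.map fun l => β l • (Pi.single l 1 : Fin n → ℕ)).sum) /
          multiFactorial γ := by
    induction L with
    | nil => simpa using h
    | cons l L ih =>
      simpa [add_assoc] using iterate_partialDeriv (c := fun γ => c (γ + _)) ih l (β l)
  have hsum : ((List.finRange n).map fun l => β l • (Pi.single l 1 : Fin n → ℕ)).sum = β := by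
    rw [← List.ofFn_eq_map, List.sum_ofFn]
    funext j
    simp [Finset.sum_apply, Pi.single_apply]
  simpa only [SwitchedKoopman.multiDeriv, hsum] using hfold (List.finRange n)

theorem taylorCoeff_eq (h : HasMonoSeries s f a) (hs : 0 < s) (β : Fin n → ℕ) :
    taylorCoeff f β = a β := by
  have hexp : HasMonoSeries s f fun β => a β * multiFactorial β / multiFactorial β := by
    simpa only [mul_div_cancel_right₀ _ (multiFactorial_ne_zero _)] using h
  have hfact : multiFactorial (0 : Fin n → ℕ) = 1 := by simp [multiFactorial]
  rw [taylorCoeff, (hexp.multiDeriv β).apply_zero hs, ← multiFactorial, zero_add, hfact,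
    Nat.cast_one, div_one, mul_div_cancel_right₀ _ (multiFactorial_ne_zero β)]

theorem fderiv_zero_single (h : HasMonoSeries s f a) (hs : 0 < s) (l : Fin n) :
    fderiv ℂ f 0 (Pi.single l 1) = a (Pi.single l 1) := by
  simpa [SwitchedKoopman.partialDeriv] using (h.partialDeriv l).apply_zero hs

end HasMonoSeries

/-! ### Products of monomial series and linear substitutions -/

open Classical in
/-- The coefficients of `z^δ f`, where `a` are those of `f`. -/
noncomputable def shiftCoeff (δ : Fin n → ℕ) (a : (Fin n → ℕ) → ℂ) (γ : Fin n → ℕ) : ℂ :=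
  if δ ≤ γ then a (γ - δ) else 0

theorem shiftCoeff_add (δ : Fin n → ℕ) (a : (Fin n → ℕ) → ℂ) (η : Fin n → ℕ) :
    shiftCoeff δ a (η + δ) = a η := by
  rw [shiftCoeff, if_pos (by simp), add_tsub_cancel_right]

theorem shiftCoeff_of_not_le {δ γ : Fin n → ℕ} (a : (Fin n → ℕ) → ℂ) (h : ¬δ ≤ γ) :
    shiftCoeff δ a γ = 0 :=
  if_neg h

theorem shiftCoeff_of_notMem_range {δ γ : Fin n → ℕ} (a : (Fin n → ℕ) → ℂ)
    (h : γ ∉ range fun η => η + δ) : shiftCoeff δ a γ = 0 :=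
  shiftCoeff_of_not_le a fun hle => h ⟨γ - δ, tsub_add_cancel_of_le hle⟩

theorem tsum_enorm_shiftCoeff_mul (δ : Fin n → ℕ) (a : (Fin n → ℕ) → ℂ)
    (g : (Fin n → ℕ) → ℝ≥0∞) :
    ∑' γ, ‖shiftCoeff δ a γ‖ₑ * g γ = ∑' η, ‖a η‖ₑ * g (η + δ) := by
  rw [← (add_left_injective δ).tsum_eq]
  · simp only [shiftCoeff_add]
  · intro γ hγ
    by_contra hc
    exact hγ (by simp [shiftCoeff_of_notMem_range a hc])

theorem HasMonoSeries.mono_mul {s : ℝ} {f : (Fin n → ℂ) → ℂ} {a : (Fin n → ℕ) → ℂ}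
    (h : HasMonoSeries s f a) (δ : Fin n → ℕ) :
    HasMonoSeries s (fun w => mono δ w * f w) (shiftCoeff δ a) := fun w hw => by
  rw [← (add_left_injective δ).hasSum_iff]
  · refine ((h w hw).mul_left (mono δ w)).congr_fun fun η => ?_
    simp only [Function.comp, shiftCoeff_add, mono_add]
    ring
  · intro γ hγ
    rw [shiftCoeff_of_notMem_range a hγ, zero_mul]

/-- `f` is the sum of a monomial series of weighted `ℓ¹` norm at most `A` on the polydisk of
radius `s`. -/
def MonoSeriesBound (s : ℝ≥0) (A : ℝ≥0∞) (f : (Fin n → ℂ) → ℂ) : Prop :=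
  ∃ a, HasMonoSeries s f a ∧ ∑' β, ‖a β‖ₑ * (s : ℝ≥0∞) ^ deg β ≤ A

theorem monoSeriesBound_one (s : ℝ≥0) : MonoSeriesBound s 1 (fun _ : Fin n → ℂ => 1) := by
  refine ⟨Pi.single 0 1, hasMonoSeries_one s, ?_⟩
  rw [tsum_eq_single 0 fun β hβ => by simp [hβ]]
  simp [deg]

theorem MonoSeriesBound.linear_mul {s : ℝ≥0} {A : ℝ≥0∞} {f : (Fin n → ℂ) → ℂ}
    (h : MonoSeriesBound s A f) (p : Fin n → ℂ) :
    MonoSeriesBound s ((∑ k, ‖p k‖ₑ) * s * A) fun w => (∑ k, p k * w k) * f w := by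
  obtain ⟨a, ha, hA⟩ := h
  refine ⟨fun γ => ∑ k, p k * shiftCoeff (Pi.single k 1) a γ,
    (HasMonoSeries.sum Finset.univ fun k _ =>
      (ha.mono_mul (Pi.single k 1)).const_mul (p k)).congr fun w _ => ?_, ?_⟩
  · simp only [mono_single, Finset.sum_mul, mul_assoc]
  calc ∑' γ, ‖∑ k, p k * shiftCoeff (Pi.single k 1) a γ‖ₑ * (s : ℝ≥0∞) ^ deg γ
      ≤ ∑' γ, ∑ k, ‖p k‖ₑ * (‖shiftCoeff (Pi.single k 1) a γ‖ₑ * (s : ℝ≥0∞) ^ deg γ) := by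
        refine ENNReal.tsum_le_tsum fun γ => ?_
        simp_rw [← mul_assoc, ← Finset.sum_mul, ← enorm_mul]
        gcongr
        exact enorm_sum_le _ _
    _ = ∑ k, ‖p k‖ₑ * ∑' η, ‖a η‖ₑ * (s : ℝ≥0∞) ^ deg η * s := by
        rw [Summable.tsum_finsetSum fun _ _ => ENNReal.summable]
        refine Finset.sum_congr rfl fun k _ => ?_
        rw [ENNReal.tsum_mul_left, tsum_enorm_shiftCoeff_mul]
        simp_rw [deg_add, deg_single, pow_succ, mul_assoc]
    _ ≤ (∑ k, ‖p k‖ₑ) * s * A := by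
        rw [ENNReal.tsum_mul_right, ← Finset.sum_mul, mul_assoc, mul_comm (s : ℝ≥0∞)]
        gcongr

section InfNorm

attribute [local instance] Matrix.linftyOpNormedAddCommGroup

theorem norm_mulVec_le (A : Matrix (Fin n) (Fin n) ℂ) (v : Fin n → ℂ) :
    ‖A.mulVec v‖ ≤ infNorm A * ‖v‖ := by
  have hA : infNorm A = ‖A‖₊ := (Matrix.linfty_opNNNorm_def A).symm
  rw [hA]
  exact Matrix.linfty_opNorm_mulVec A v

end InfNorm

theorem sum_enorm_row_le_infNorm (A : Matrix (Fin n) (Fin n) ℂ) (l : Fin n) :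
    ∑ k, ‖A l k‖ₑ ≤ infNorm A := by
  simp_rw [enorm_eq_nnnorm]
  exact_mod_cast Finset.le_sup (f := fun i => ∑ j, ‖A i j‖₊) (Finset.mem_univ l)

theorem monoSeriesBound_mulVec_pow_mul {s : ℝ≥0} {P : Matrix (Fin n) (Fin n) ℂ}
    (hP : infNorm P * s ≤ 1) {f : (Fin n → ℂ) → ℂ} (hf : MonoSeriesBound s 1 f)
    (l : Fin n) (k : ℕ) : MonoSeriesBound s 1 fun w => P.mulVec w l ^ k * f w := by
  induction k with
  | zero => simpa using hf
  | succ k ih =>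
    simp_rw [pow_succ', mul_assoc]
    obtain ⟨a, ha, hA⟩ := ih.linear_mul (P l)
    refine ⟨a, ha, hA.trans ?_⟩
    calc (∑ k, ‖P l k‖ₑ) * s * 1 ≤ infNorm P * s * 1 := by
          gcongr
          exact sum_enorm_row_le_infNorm P l
      _ ≤ 1 := by
          rw [mul_one]
          exact_mod_cast hP

theorem monoSeriesBound_mono_comp_mulVec {s : ℝ≥0} {P : Matrix (Fin n) (Fin n) ℂ}
    (hP : infNorm P * s ≤ 1) (δ : Fin n → ℕ) :
    MonoSeriesBound s 1 fun w => mono δ (P.mulVec w) := by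
  suffices ∀ S : Finset (Fin n), MonoSeriesBound s 1 fun w => ∏ l ∈ S, P.mulVec w l ^ δ l from
    this Finset.univ
  intro S
  induction S using Finset.induction_on with
  | empty => simpa using monoSeriesBound_one s
  | insert l S hl ih =>
    simp_rw [Finset.prod_insert hl]
    exact monoSeriesBound_mulVec_pow_mul hP ih l _

theorem enorm_mono_le (β : Fin n → ℕ) {w : Fin n → ℂ} {s : ℝ≥0} (hw : ‖w‖ ≤ s) :
    ‖mono β w‖ₑ ≤ (s : ℝ≥0∞) ^ deg β := by
  rw [← ENNReal.coe_pow, enorm_eq_nnnorm, ENNReal.coe_le_coe, ← NNReal.coe_le_coe]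
  simpa using norm_mono_le β hw

theorem hasMonoSeries_of_hasSum {ι : Type*} {s : ℝ≥0} {f : (Fin n → ℂ) → ℂ}
    {g : ι → (Fin n → ℂ) → ℂ} {c : ι → ℂ} (hc : Summable fun δ => ‖c δ‖)
    (hg : ∀ δ, MonoSeriesBound s 1 (g δ))
    (hf : ∀ w ∈ Metric.ball (0 : Fin n → ℂ) s, HasSum (fun δ => c δ * g δ w) (f w)) :
    ∃ b, HasMonoSeries s f b := by
  choose C hC hC1 using hg
  refine ⟨fun β => ∑' δ, c δ * C δ β, fun w hw => ?_⟩
  have hsummable : Summable fun p : ι × (Fin n → ℕ) => c p.1 * C p.1 p.2 * mono p.2 w := by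
    refine Summable.of_enorm (ne_top_of_le_ne_top (b := ∑' δ, ‖c δ‖ₑ) ?_ ?_)
    · simpa [ofReal_norm] using hc.tsum_ofReal_ne_top
    rw [ENNReal.tsum_prod (f := fun δ β => ‖c δ * C δ β * mono β w‖ₑ)]
    refine ENNReal.tsum_le_tsum fun δ => ?_
    simp_rw [mul_assoc, enorm_mul]
    rw [ENNReal.tsum_mul_left]
    refine mul_le_of_le_one_right' (le_trans (ENNReal.tsum_le_tsum fun β => ?_) (hC1 δ))
    gcongr
    exact enorm_mono_le β (mem_ball_zero_iff.1 hw).le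
  have hsum : HasSum (fun p : ι × (Fin n → ℕ) => c p.1 * C p.1 p.2 * mono p.2 w) (f w) := by
    have hfiber := hsummable.hasSum.prod_fiberwise (g := fun δ => c δ * g δ w) fun δ => by
      simpa only [mul_assoc] using (hC δ w hw).mul_left (c δ)
    rw [(hf w hw).unique hfiber]
    exact hsummable.hasSum
  have hswap := (Equiv.prodComm _ _).hasSum_iff.2 hsum
  refine hswap.prod_fiberwise fun β => ?_
  have hfactor : Summable fun δ => c δ * C δ β * mono β w := hswap.summable.prod_factor β
  simpa [tsum_mul_right] using hfactor.hasSum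

theorem HasSummableTaylor.exists_hasMonoSeries_comp_mulVec {f : (Fin n → ℂ) → ℂ}
    (hf : HasSummableTaylor f) (P : Matrix (Fin n) (Fin n) ℂ) :
    ∃ s > 0, ∃ b, HasMonoSeries s (fun w => f (P.mulVec w)) b := by
  obtain ⟨c, hc, hf⟩ := hf
  rw [polydisk_eq_ball one_pos] at hf
  have hpos : 0 < infNorm P + 1 := by positivity
  have hle : infNorm P * (infNorm P + 1)⁻¹ ≤ 1 := by
    rw [← div_eq_mul_inv]
    exact div_le_one_of_le₀ le_self_add zero_le
  refine ⟨((infNorm P + 1)⁻¹ : ℝ≥0), by positivity, hasMonoSeries_of_hasSum hc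
    (monoSeriesBound_mono_comp_mulVec hle) fun w hw => hf _ ?_⟩
  rw [mem_ball_zero_iff] at hw ⊢
  calc ‖P.mulVec w‖ ≤ infNorm P * ‖w‖ := norm_mulVec_le P w
    _ ≤ (infNorm P + 1 : ℝ≥0) * ‖w‖ := by gcongr; exact le_self_add
    _ < (infNorm P + 1 : ℝ≥0) * ((infNorm P + 1)⁻¹ : ℝ≥0) := by gcongr
    _ = 1 := by rw [← NNReal.coe_mul, mul_inv_cancel₀ hpos.ne', NNReal.coe_one]

/-! ### The Koopman matrix -/

/-- The entry `⟨L_G z^β, z^γ⟩` of the Koopman matrix in terms of the Taylor coefficients `b l` of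
the components of `G`. -/
noncomputable def koopmanCoeff (b : Fin n → (Fin n → ℕ) → ℂ) (β γ : Fin n → ℕ) : ℂ :=
  ∑ l, (β l : ℂ) * shiftCoeff (β - Pi.single l 1) (b l) γ

theorem koopmanGenerator_mono (G : (Fin n → ℂ) → Fin n → ℂ) (β : Fin n → ℕ) (w : Fin n → ℂ) :
    koopmanGenerator G (mono β) w = monoDeriv β w (G w) := by
  rw [koopmanGenerator, (hasFDerivAt_mono β w).fderiv]

section Koopman

variable {s : ℝ} {G : (Fin n → ℂ) → Fin n → ℂ} {b : Fin n → (Fin n → ℕ) → ℂ}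

theorem hasMonoSeries_koopmanGenerator (h : ∀ l, HasMonoSeries s (fun w => G w l) (b l))
    (β : Fin n → ℕ) : HasMonoSeries s (koopmanGenerator G (mono β)) (koopmanCoeff b β) :=
  (HasMonoSeries.sum Finset.univ fun l _ =>
    ((h l).mono_mul (β - Pi.single l 1)).const_mul (β l : ℂ)).congr fun w _ => by
      simp only [koopmanGenerator_mono, monoDeriv_apply, mul_assoc]

theorem koopmanEntry_eq (hs : 0 < s) (h : ∀ l, HasMonoSeries s (fun w => G w l) (b l))
    (β γ : Fin n → ℕ) : koopmanEntry G β γ = koopmanCoeff b β γ :=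
  (hasMonoSeries_koopmanGenerator h β).taylorCoeff_eq hs γ

theorem koopmanCoeff_zero_left (b : Fin n → (Fin n → ℕ) → ℂ) (γ : Fin n → ℕ) :
    koopmanCoeff b 0 γ = 0 := by
  simp [koopmanCoeff]

theorem koopmanCoeff_self (b : Fin n → (Fin n → ℕ) → ℂ) (β : Fin n → ℕ) :
    koopmanCoeff b β β = ∑ l, (β l : ℂ) * b l (Pi.single l 1) := by
  refine Finset.sum_congr rfl fun l _ => ?_
  by_cases hl : β l = 0
  · simp [hl]
  have hshift := shiftCoeff_add (β - Pi.single l 1) (b l) (Pi.single l 1)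
  rw [add_comm, sub_single_add_single hl] at hshift
  rw [hshift]

theorem koopmanCoeff_single (b : Fin n → (Fin n → ℕ) → ℂ) (l : Fin n) (γ : Fin n → ℕ) :
    koopmanCoeff b (Pi.single l 1) γ = b l γ := by
  rw [koopmanCoeff, Finset.sum_eq_single l]
  · simp [shiftCoeff]
  · intro j _ hj
    simp [hj]
  · simp

/-- The terms of order at least two of a family of power series. -/
def highOrder (b : Fin n → (Fin n → ℕ) → ℂ) (l : Fin n) (η : Fin n → ℕ) : ℂ :=
  if deg η ≤ 1 then 0 else b l η

theorem highOrder_of_le {η : Fin n → ℕ} (h : deg η ≤ 1) (l : Fin n) : highOrder b l η = 0 :=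
  if_pos h

theorem highOrder_of_lt {η : Fin n → ℕ} (h : 1 < deg η) (l : Fin n) : highOrder b l η = b l η :=
  if_neg (not_le.2 h)

theorem natCast_mul_shiftCoeff_highOrder (b : Fin n → (Fin n → ℕ) → ℂ) (β γ : Fin n → ℕ)
    (l : Fin n) : (β l : ℂ) * shiftCoeff (β - Pi.single l 1) (highOrder b l) γ =
      if deg β < deg γ then (β l : ℂ) * shiftCoeff (β - Pi.single l 1) (b l) γ else 0 := by
  by_cases hl : β l = 0
  · simp [hl]
  by_cases hle : β - Pi.single l 1 ≤ γ
  · obtain ⟨η, rfl⟩ : ∃ η, γ = η + (β - Pi.single l 1) := ⟨_, (tsub_add_cancel_of_le hle).symm⟩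
    rw [shiftCoeff_add, shiftCoeff_add, deg_add, ← deg_sub_single_add_one hl]
    rcases le_or_gt (deg η) 1 with hη | hη
    · rw [highOrder_of_le hη, if_neg (by omega), mul_zero]
    · rw [highOrder_of_lt hη, if_pos (by omega)]
  · simp [shiftCoeff_of_not_le _ hle]

theorem koopmanCoeff_highOrder (b : Fin n → (Fin n → ℕ) → ℂ) (β γ : Fin n → ℕ) :
    koopmanCoeff (highOrder b) β γ = if deg β < deg γ then koopmanCoeff b β γ else 0 := by
  rw [koopmanCoeff, Finset.sum_congr rfl fun l _ => natCast_mul_shiftCoeff_highOrder b β γ l]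
  split_ifs <;> simp [koopmanCoeff]

theorem deg_le_of_koopmanCoeff_ne_zero (hb : ∀ l, b l 0 = 0) {β γ : Fin n → ℕ}
    (h : koopmanCoeff b β γ ≠ 0) : deg β ≤ deg γ := by
  obtain ⟨l, -, hl⟩ := Finset.exists_ne_zero_of_sum_ne_zero h
  have hβ : β l ≠ 0 := fun hβ => hl (by simp [hβ])
  have hle : β - Pi.single l 1 ≤ γ := by
    by_contra hle
    exact hl (by rw [shiftCoeff_of_not_le _ hle, mul_zero])
  obtain ⟨η, rfl⟩ : ∃ η, γ = η + (β - Pi.single l 1) := ⟨_, (tsub_add_cancel_of_le hle).symm⟩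
  have hη : deg η ≠ 0 := fun hη => hl (by
    rw [shiftCoeff_add, deg_eq_zero.1 hη, hb, mul_zero])
  rw [deg_add, ← deg_sub_single_add_one hβ]
  omega

theorem tsum_enorm_koopmanCoeff_row_le (b : Fin n → (Fin n → ℕ) → ℂ) (β : Fin n → ℕ) :
    ∑' γ, ‖koopmanCoeff b β γ‖ₑ ≤ ∑ l, (β l : ℝ≥0∞) * ∑' η, ‖b l η‖ₑ := by
  calc ∑' γ, ‖koopmanCoeff b β γ‖ₑ
      ≤ ∑' γ, ∑ l, (β l : ℝ≥0∞) * ‖shiftCoeff (β - Pi.single l 1) (b l) γ‖ₑ := by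
        refine ENNReal.tsum_le_tsum fun γ => (enorm_sum_le _ _).trans_eq ?_
        refine Finset.sum_congr rfl fun l _ => ?_
        rw [enorm_mul, enorm_eq_nnnorm (β l : ℂ), Complex.nnnorm_natCast, ENNReal.coe_natCast]
    _ = ∑ l, (β l : ℝ≥0∞) * ∑' η, ‖b l η‖ₑ := by
        rw [Summable.tsum_finsetSum fun _ _ => ENNReal.summable]
        refine Finset.sum_congr rfl fun l _ => ?_
        rw [ENNReal.tsum_mul_left]
        congr 1
        simpa using tsum_enorm_shiftCoeff_mul (β - Pi.single l 1) (b l) fun _ => 1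

theorem tsum_enorm_koopmanCoeff_col_ne_top (hb : ∀ l, b l 0 = 0) (γ : Fin n → ℕ) :
    ∑' β, ‖koopmanCoeff b β γ‖ₑ ≠ ⊤ := by
  rw [tsum_eq_sum (s := (finite_deg_le (n := n) (deg γ)).toFinset)]
  · exact ENNReal.sum_ne_top.2 fun _ _ => enorm_ne_top
  · intro β hβ
    by_contra hc
    exact hβ (by simpa using deg_le_of_koopmanCoeff_ne_zero hb (enorm_ne_zero.1 hc))

theorem HasMonoSeries.sub_linear (hb : ∀ l, b l 0 = 0)
    (h : ∀ l, HasMonoSeries s (fun w => G w l) (b l)) (l : Fin n) :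
    HasMonoSeries s (fun w => G w l - ∑ r, b l (Pi.single r 1) * w r) (highOrder b l) := by
  intro w hw
  have hinj : Function.Injective fun r : Fin n => (Pi.single r 1 : Fin n → ℕ) :=
    fun r q hrq => by
      by_contra hne
      simpa [hne] using congrFun hrq r
  have hlinear : HasSum (fun η => (b l η - highOrder b l η) * mono η w)
      (∑ r, b l (Pi.single r 1) * w r) := by
    rw [← hinj.hasSum_iff]
    · convert hasSum_fintype fun r => b l (Pi.single r 1) * w r using 2 with r
      simp [highOrder]
    · intro η hη
      rcases lt_or_ge 1 (deg η) with hlt | hle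
      · rw [highOrder_of_lt hlt, sub_self, zero_mul]
      · have hη0 : η = 0 := by
          rw [← deg_eq_zero]
          by_contra hne
          obtain ⟨r, rfl⟩ := deg_eq_one.1 (show deg η = 1 by omega)
          exact hη ⟨r, rfl⟩
        rw [highOrder_of_le hle, hη0, hb, sub_zero, zero_mul]
  refine ((h l w hw).sub hlinear).congr_fun fun η => ?_
  ring

end Koopman

/-! ### A weighted Schur test -/

theorem le_half_mul_add_of_sq_le {u κ p q : ℝ≥0} (h : u ^ 2 ≤ κ ^ 2 * (p * q)) :
    u ≤ κ / 2 * (p + q) := by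
  rw [← pow_le_pow_iff_left₀ zero_le zero_le two_ne_zero]
  refine h.trans ?_
  rw [← NNReal.coe_le_coe]
  push_cast
  nlinarith [sq_nonneg ((κ : ℝ) * (p - q))]

theorem mul_le_half_mul_add_of_sq_mul_le {k u κ p q r c : ℝ≥0} (hr : k ≤ r) (hc : k ≤ c)
    (hu : k ≠ 0 → u ^ 2 * (r * c) ≤ κ ^ 2 * (p * q)) :
    k * u ≤ κ / 2 * (p / r * k) + κ / 2 * (q / c * k) := by
  by_cases hk : k = 0
  · simp [hk]
  have hr : 0 < r := (pos_iff_ne_zero.2 hk).trans_le hr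
  have hc : 0 < c := (pos_iff_ne_zero.2 hk).trans_le hc
  have husq : u ^ 2 ≤ κ ^ 2 * (p / r * (q / c)) := by
    rw [div_mul_div_comm, ← mul_div_assoc, le_div_iff₀ (by positivity)]
    exact hu hk
  calc k * u ≤ k * (κ / 2 * (p / r + q / c)) := by gcongr; exact le_half_mul_add_of_sq_le husq
    _ = κ / 2 * (p / r * k) + κ / 2 * (q / c * k) := by ring

theorem coe_div_mul_le {a S : ℝ≥0} {t : ℝ≥0∞} (ht : t ≤ S) :
    ((a / S : ℝ≥0) : ℝ≥0∞) * t ≤ a := by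
  have hdiv : a / S * S ≤ a := by
    rcases eq_or_ne S 0 with rfl | hS
    · simp
    · exact (div_mul_cancel₀ a hS).le
  calc ((a / S : ℝ≥0) : ℝ≥0∞) * t ≤ ((a / S * S : ℝ≥0) : ℝ≥0∞) := by
        rw [ENNReal.coe_mul]
        gcongr
    _ ≤ a := ENNReal.coe_le_coe.2 hdiv

theorem tsum_mul_le_of_schur {ι : Type*} {k u : ι → ι → ℝ≥0} {R C y : ι → ℝ≥0} {κ : ℝ≥0}
    (hR : ∀ β, ∑' γ, (k β γ : ℝ≥0∞) ≤ R β) (hC : ∀ γ, ∑' β, (k β γ : ℝ≥0∞) ≤ C γ)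
    (hu : ∀ β γ, k β γ ≠ 0 → u β γ ^ 2 * (R β * C γ) ≤ κ ^ 2 * (y β * y γ)) :
    ∑' β, ∑' γ, ((k β γ * u β γ : ℝ≥0) : ℝ≥0∞) ≤ κ * ∑' β, (y β : ℝ≥0∞) := by
  have hkR (β γ : ι) : k β γ ≤ R β := by exact_mod_cast (ENNReal.le_tsum γ).trans (hR β)
  have hkC (β γ : ι) : k β γ ≤ C γ := by exact_mod_cast (ENNReal.le_tsum β).trans (hC γ)
  calc ∑' β, ∑' γ, ((k β γ * u β γ : ℝ≥0) : ℝ≥0∞)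
      ≤ ∑' β, ∑' γ, ((κ / 2 : ℝ≥0) * ((y β / R β : ℝ≥0) * (k β γ : ℝ≥0∞)) +
          (κ / 2 : ℝ≥0) * ((y γ / C γ : ℝ≥0) * (k β γ : ℝ≥0∞))) := by
        gcongr with β γ
        exact_mod_cast mul_le_half_mul_add_of_sq_mul_le (hkR β γ) (hkC β γ) (hu β γ)
    _ = (κ / 2 : ℝ≥0) * ∑' β, (y β / R β : ℝ≥0) * ∑' γ, (k β γ : ℝ≥0∞) +
          (κ / 2 : ℝ≥0) * ∑' γ, (y γ / C γ : ℝ≥0) * ∑' β, (k β γ : ℝ≥0∞) := by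
        simp_rw [ENNReal.tsum_add, ENNReal.tsum_mul_left]
        congr 2
        rw [ENNReal.tsum_comm]
        simp_rw [ENNReal.tsum_mul_left]
    _ ≤ (κ / 2 : ℝ≥0) * ∑' β, (y β : ℝ≥0∞) + (κ / 2 : ℝ≥0) * ∑' β, (y β : ℝ≥0∞) := by
        gcongr with β γ
        · exact coe_div_mul_le (hR β)
        · exact coe_div_mul_le (hC γ)
    _ = κ * ∑' β, (y β : ℝ≥0∞) := by
        rw [← add_mul, ← ENNReal.coe_add, add_halves]

/-! ### The Lyapunov function -/

/-- The weighted degree `∑ β_l d_l`: when the linear part of a vector field is triangular with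
diagonal real parts `-d_l`, the Koopman matrix has real part `-diagWeight d β` at `(z^β, z^β)`. -/
def diagWeight (d : Fin n → ℝ≥0) (β : Fin n → ℕ) : ℝ≥0 := ∑ l, (β l : ℝ≥0) * d l

section DiagWeight

variable {d : Fin n → ℝ≥0} {β : Fin n → ℕ}

theorem diagWeight_add_single (d : Fin n → ℝ≥0) (η : Fin n → ℕ) (q : Fin n) :
    diagWeight d (η + Pi.single q 1) = diagWeight d η + d q := by
  simp only [diagWeight, Pi.add_apply, Nat.cast_add, add_mul, Finset.sum_add_distrib]
  congr 1
  rw [Finset.sum_eq_single q] <;> simp +contextual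

theorem mul_le_diagWeight (d : Fin n → ℝ≥0) (β : Fin n → ℕ) (q : Fin n) :
    (β q : ℝ≥0) * d q ≤ diagWeight d β :=
  Finset.single_le_sum (f := fun l => (β l : ℝ≥0) * d l) (fun _ _ => zero_le) (Finset.mem_univ q)

theorem le_diagWeight {c : ℝ≥0} (hc : ∀ l, c ≤ d l) (hβ : β ≠ 0) : c ≤ diagWeight d β := by
  obtain ⟨l, hl⟩ := Function.ne_iff.1 hβ
  have hone : (1 : ℝ≥0) ≤ β l := by exact_mod_cast Nat.one_le_iff_ne_zero.2 hl
  exact (hc l).trans ((le_mul_of_one_le_left zero_le hone).trans (mul_le_diagWeight d β l))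

theorem diagWeight_pos (hd : ∀ l, 0 < d l) (hβ : β ≠ 0) : 0 < diagWeight d β := by
  obtain ⟨l, hl⟩ := Function.ne_iff.1 hβ
  have hpos : (0 : ℝ≥0) < β l := by exact_mod_cast Nat.pos_of_ne_zero hl
  exact (mul_pos hpos (hd l)).trans_le (mul_le_diagWeight d β l)

theorem monoDeriv_mul_coord (d : Fin n → ℝ≥0) (β : Fin n → ℕ) (w : Fin n → ℂ) :
    (monoDeriv β w fun l => (d l : ℂ) * w l) = (diagWeight d β : ℂ) * mono β w := by
  rw [monoDeriv_apply, diagWeight, NNReal.coe_sum, Complex.ofReal_sum, Finset.sum_mul]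
  refine Finset.sum_congr rfl fun l _ => ?_
  by_cases hl : β l = 0
  · simp [hl]
  · rw [← mono_sub_single_mul hl]
    push_cast
    ring

end DiagWeight

/-- The vector of squared moduli of the coordinates. -/
noncomputable def sqModulus (w : Fin n → ℂ) (l : Fin n) : ℂ := ((‖w l‖ ^ 2 : ℝ) : ℂ)

theorem sqModulus_zero : sqModulus (0 : Fin n → ℂ) = 0 := by
  funext l
  simp [sqModulus]

theorem continuous_sqModulus : Continuous (sqModulus : (Fin n → ℂ) → Fin n → ℂ) := by
  unfold sqModulus
  fun_prop

theorem sqModulus_mem_ball {w : Fin n → ℂ} {ρ : ℝ} (hw : ‖w‖ < ρ) :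
    sqModulus w ∈ Metric.ball (0 : Fin n → ℂ) (ρ ^ 2) := by
  have hρ : 0 < ρ := (norm_nonneg _).trans_lt hw
  rw [mem_ball_zero_iff, pi_norm_lt_iff (by positivity)]
  intro l
  rw [sqModulus, Complex.norm_real, Real.norm_of_nonneg (by positivity)]
  have := (norm_le_pi_norm w l).trans_lt hw
  gcongr

theorem mono_sqModulus (β : Fin n → ℕ) (w : Fin n → ℂ) :
    mono β (sqModulus w) = ((‖mono β w‖ ^ 2 : ℝ) : ℂ) := by
  rw [norm_mono, ← Finset.prod_pow, mono, Complex.ofReal_prod]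
  refine Finset.prod_congr rfl fun l _ => ?_
  rw [sqModulus, ← Complex.ofReal_pow, pow_right_comm]

theorem hasDerivWithinAt_sqModulus {w : ℝ → Fin n → ℂ} {w' : Fin n → ℂ} {S : Set ℝ} {t : ℝ}
    (h : HasDerivWithinAt w w' S t) :
    HasDerivWithinAt (fun s => sqModulus (w s))
      (fun l => ((2 * (conj (w t l) * w' l).re : ℝ) : ℂ)) S t := by
  refine hasDerivWithinAt_pi.2 fun l => ?_
  have hsq := (hasDerivWithinAt_pi.1 h l).norm_sq.ofReal_comp
  rw [Complex.inner, mul_comm (w' l)] at hsq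
  exact hsq

theorem monoDeriv_sqModulus (β : Fin n → ℕ) (w v : Fin n → ℂ) :
    monoDeriv β (sqModulus w) (fun l => ((2 * (conj (w l) * v l).re : ℝ) : ℂ)) =
      ((2 * (conj (mono β w) * monoDeriv β w v).re : ℝ) : ℂ) := by
  rw [monoDeriv_apply, monoDeriv_apply, Finset.mul_sum, Complex.re_sum, Finset.mul_sum,
    Complex.ofReal_sum]
  refine Finset.sum_congr rfl fun l _ => ?_
  by_cases hl : β l = 0
  · simp [hl]
  have hfactor : conj (mono β w) * ((β l : ℂ) * mono (β - Pi.single l 1) w * v l) =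
      (((β l : ℝ) * ‖mono (β - Pi.single l 1) w‖ ^ 2 : ℝ) : ℂ) * (conj (w l) * v l) := by
    rw [← mono_sub_single_mul hl, map_mul, Complex.ofReal_mul, Complex.ofReal_pow,
      ← Complex.conj_mul', Complex.ofReal_natCast]
    ring
  rw [hfactor, Complex.re_ofReal_mul, mono_sqModulus]
  push_cast
  ring

theorem summable_pow_deg {t : ℝ} (ht0 : 0 ≤ t) (ht1 : t < 1) (n : ℕ) :
    Summable fun β : Fin n → ℕ => t ^ deg β := by
  induction n with
  | zero => exact (hasSum_fintype _).summable
  | succ n ih =>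
    rw [← (Fin.consEquiv fun _ : Fin (n + 1) => ℕ).summable_iff]
    refine ((summable_geometric_of_lt_one ht0 ht1).mul_of_nonneg ih (fun _ => by positivity)
      fun _ => by positivity).congr fun p => ?_
    simp [deg, Fin.sum_univ_succ, pow_add]

/-- A sequence of weights for the functions `∑ ε_{|β|} |w^β|²`, with growth slow enough for
convergence on the polydisk of radius `ρ`. -/
structure IsLyapunovWeight (ρ : ℝ≥0) (ε : ℕ → ℝ≥0) : Prop where
  zero : ε 0 = 0
  one_pos : 0 < ε 1
  exists_le : ∃ M, ∀ k, ε k ≤ M * (ρ ^ 2)⁻¹ ^ k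

/-- The series `∑ ε_{|β|} p^β`. The Lyapunov function is its value at the vector of squared
moduli, which makes it a holomorphic function of real arguments and so differentiable termwise. -/
noncomputable def weightSeries (ε : ℕ → ℝ≥0) (p : Fin n → ℂ) : ℂ :=
  ∑' β, (ε (deg β) : ℂ) * mono β p

/-- The Lyapunov function `∑ ε_{|β|} |w^β|²`. -/
noncomputable def lyapunov (ε : ℕ → ℝ≥0) (w : Fin n → ℂ) : ℝ := (weightSeries ε (sqModulus w)).re

/-- The derivative of the Lyapunov function at `w` in the direction `v`. -/
noncomputable def lyapunovDeriv (ε : ℕ → ℝ≥0) (w v : Fin n → ℂ) : ℝ :=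
  ∑' β, (ε (deg β) : ℝ) * (2 * (conj (mono β w) * monoDeriv β w v).re)

/-- The decay `∑ ε_{|β|} (∑ β_l d_l) |w^β|²` of the Lyapunov function that comes from the diagonal
of the linear part. -/
noncomputable def dissipation (ε : ℕ → ℝ≥0) (d : Fin n → ℝ≥0) (w : Fin n → ℂ) : ℝ≥0 :=
  ∑' β, ε (deg β) * (diagWeight d β * ‖mono β w‖₊ ^ 2)

namespace IsLyapunovWeight

variable {ρ : ℝ≥0} {ε : ℕ → ℝ≥0} {w : Fin n → ℂ}

theorem hasMonoSeries (hε : IsLyapunovWeight ρ ε) (hρ : 0 < ρ) :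
    HasMonoSeries ((ρ : ℝ) ^ 2) (weightSeries (n := n) ε) fun β => (ε (deg β) : ℂ) := by
  intro p hp
  rw [mem_ball_zero_iff] at hp
  obtain ⟨M, hM⟩ := hε.exists_le
  have hρ' : (0 : ℝ) < (ρ : ℝ) ^ 2 := by positivity
  refine (Summable.of_norm_bounded ((summable_pow_deg (t := ‖p‖ / (ρ : ℝ) ^ 2) (by positivity)
    ((div_lt_one hρ').2 hp) n).mul_left (M : ℝ)) fun β => ?_).hasSum
  have hεM : (ε (deg β) : ℝ) ≤ M * ((ρ : ℝ) ^ 2)⁻¹ ^ deg β := by exact_mod_cast hM (deg β)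
  rw [norm_mul, Complex.norm_real, NNReal.norm_eq]
  calc (ε (deg β) : ℝ) * ‖mono β p‖ ≤ M * ((ρ : ℝ) ^ 2)⁻¹ ^ deg β * ‖p‖ ^ deg β := by
        gcongr
        exact norm_mono_le β le_rfl
    _ = M * (‖p‖ / (ρ : ℝ) ^ 2) ^ deg β := by rw [div_eq_mul_inv, mul_pow]; ring

theorem hasSum_lyapunov (hε : IsLyapunovWeight ρ ε) (hw : ‖w‖ < ρ) :
    HasSum (fun β => (ε (deg β) : ℝ) * ‖mono β w‖ ^ 2) (lyapunov ε w) := by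
  have hρ : 0 < ρ := by exact_mod_cast (norm_nonneg w).trans_lt hw
  refine (Complex.hasSum_re (hε.hasMonoSeries hρ _ (sqModulus_mem_ball hw))).congr_fun fun β => ?_
  rw [mono_sqModulus, Complex.re_ofReal_mul, Complex.ofReal_re]

theorem lyapunov_zero (hε : IsLyapunovWeight ρ ε) (hρ : 0 < ρ) :
    lyapunov ε (0 : Fin n → ℂ) = 0 := by
  rw [lyapunov, sqModulus_zero, (hε.hasMonoSeries hρ).apply_zero (by positivity)]
  simp [deg, hε.zero]

theorem continuousAt_lyapunov (hε : IsLyapunovWeight ρ ε) (hw : ‖w‖ < ρ) :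
    ContinuousAt (lyapunov ε) w := by
  have hρ : 0 < ρ := by exact_mod_cast (norm_nonneg w).trans_lt hw
  have hseries := ((hε.hasMonoSeries hρ).differentiableAt (sqModulus_mem_ball hw)).continuousAt
  exact Complex.continuous_re.continuousAt.comp
    (hseries.comp continuous_sqModulus.continuousAt)

theorem mul_sq_norm_le_lyapunov (hε : IsLyapunovWeight ρ ε) (hw : ‖w‖ < ρ) :
    ε 1 * ‖w‖ ^ 2 ≤ lyapunov ε w := by
  have hsum := hε.hasSum_lyapunov hw
  have hpos : (0 : ℝ) < ε 1 := NNReal.coe_pos.2 hε.one_pos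
  have hV : 0 ≤ lyapunov ε w := hsum.nonneg fun β => by positivity
  rw [mul_comm, ← le_div_iff₀ hpos, ← Real.le_sqrt (norm_nonneg w) (by positivity),
    pi_norm_le_iff_of_nonneg (Real.sqrt_nonneg _)]
  intro l
  rw [Real.le_sqrt (norm_nonneg _) (by positivity), le_div_iff₀ hpos, mul_comm]
  simpa using le_hasSum hsum (Pi.single l 1) fun β _ => by positivity

theorem hasSum_fderiv_weightSeries (hε : IsLyapunovWeight ρ ε) (hw : ‖w‖ < ρ) (v : Fin n → ℂ) :
    HasSum (fun β => (ε (deg β) : ℝ) * (2 * (conj (mono β w) * monoDeriv β w v).re))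
      (fderiv ℂ (weightSeries ε) (sqModulus w)
        fun l => ((2 * (conj (w l) * v l).re : ℝ) : ℂ)).re := by
  have hρ : 0 < ρ := by exact_mod_cast (norm_nonneg w).trans_lt hw
  refine (Complex.hasSum_re ((hε.hasMonoSeries hρ).hasSum_fderiv_apply
    (sqModulus_mem_ball hw) _)).congr_fun fun β => ?_
  rw [monoDeriv_sqModulus, Complex.re_ofReal_mul, Complex.ofReal_re]

theorem hasSum_lyapunovDeriv (hε : IsLyapunovWeight ρ ε) (hw : ‖w‖ < ρ) (v : Fin n → ℂ) :
    HasSum (fun β => (ε (deg β) : ℝ) * (2 * (conj (mono β w) * monoDeriv β w v).re))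
      (lyapunovDeriv ε w v) :=
  (hε.hasSum_fderiv_weightSeries hw v).summable.hasSum

theorem hasDerivWithinAt_lyapunov (hε : IsLyapunovWeight ρ ε) {x : ℝ → Fin n → ℂ} {v : Fin n → ℂ}
    {S : Set ℝ} {t : ℝ} (hx : HasDerivWithinAt x v S t) (hxt : ‖x t‖ < ρ) :
    HasDerivWithinAt (fun s => lyapunov ε (x s)) (lyapunovDeriv ε (x t) v) S t := by
  have hρ : 0 < ρ := by exact_mod_cast (norm_nonneg (x t)).trans_lt hxt
  have hseries := ((hε.hasMonoSeries hρ).differentiableAt (sqModulus_mem_ball hxt)).hasFDerivAt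
  have hcomp := (hseries.restrictScalars ℝ).comp_hasDerivWithinAt t (hasDerivWithinAt_sqModulus hx)
  rw [← (hε.hasSum_fderiv_weightSeries hxt v).unique (hε.hasSum_lyapunovDeriv hxt v)]
  exact Complex.reCLM.hasFDerivAt.comp_hasDerivWithinAt t hcomp

theorem hasSum_dissipation (hε : IsLyapunovWeight ρ ε) (hw : ‖w‖ < ρ) (d : Fin n → ℝ≥0) :
    HasSum (fun β => ε (deg β) * (diagWeight d β * ‖mono β w‖₊ ^ 2)) (dissipation ε d w) := by
  refine (NNReal.summable_coe.1 ?_).hasSum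
  refine ((hε.hasSum_lyapunovDeriv hw fun l => d l * w l).summable.div_const 2).congr fun β => ?_
  have hconj : conj (mono β w) * ((diagWeight d β : ℂ) * mono β w) =
      ((diagWeight d β * ‖mono β w‖ ^ 2 : ℝ) : ℂ) := by
    rw [mul_left_comm, Complex.conj_mul']
    push_cast
    rfl
  rw [monoDeriv_mul_coord, hconj, Complex.ofReal_re]
  push_cast
  ring

theorem mul_lyapunov_le_dissipation (hε : IsLyapunovWeight ρ ε) (hw : ‖w‖ < ρ)
    {d : Fin n → ℝ≥0} {c : ℝ≥0} (hc : ∀ l, c ≤ d l) :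
    c * lyapunov ε w ≤ dissipation ε d w := by
  refine hasSum_le (fun β => ?_) ((hε.hasSum_lyapunov hw).mul_left (c : ℝ))
    (NNReal.hasSum_coe.2 (hε.hasSum_dissipation hw d))
  by_cases hβ : β = 0
  · simp [hβ, hε.zero, deg]
  · have hD : (c : ℝ) ≤ diagWeight d β := by exact_mod_cast le_diagWeight hc hβ
    push_cast
    calc (c : ℝ) * (ε (deg β) * ‖mono β w‖ ^ 2)
        ≤ diagWeight d β * (ε (deg β) * ‖mono β w‖ ^ 2) := by gcongr
      _ = ε (deg β) * (diagWeight d β * ‖mono β w‖ ^ 2) := by ring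

end IsLyapunovWeight

/-! ### The derivative of the Lyapunov function -/

/-- The matrix `T` is upper triangular with diagonal real parts `-d_l`, and its entries above the
diagonal are small compared with `d`, with constant `θ`. -/
structure IsDiagDominated (T : Matrix (Fin n) (Fin n) ℂ) (d : Fin n → ℝ≥0) (θ : ℝ≥0) : Prop where
  blockTriangular : T.BlockTriangular id
  re_diag : ∀ l, (T l l).re = -(d l : ℝ)
  sq_nnnorm_le : ∀ q r, q < r → ‖T q r‖₊ ^ 2 ≤ θ ^ 2 * (d q * d r)
  nnnorm_le : ∀ q r, q < r → ‖T q r‖₊ ≤ θ * d q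

/-- The contribution to the derivative of `|w^β|²` of the entries of `T` above the diagonal. They
couple `w^β` to monomials of the same degree. -/
noncomputable def upperCross (T : Matrix (Fin n) (Fin n) ℂ) (β : Fin n → ℕ) (w : Fin n → ℂ) :
    ℝ≥0 :=
  ∑ r, ∑ l ∈ Finset.Iio r,
    β l * ‖T l r‖₊ * (‖mono β w‖₊ * ‖mono (β - Pi.single l 1 + Pi.single r 1) w‖₊)

theorem conj_mono_mul_natCast_mul_mono_sub_single (β : Fin n → ℕ) (w : Fin n → ℂ) (l : Fin n)
    (t : ℂ) :
    conj (mono β w) * ((β l : ℂ) * mono (β - Pi.single l 1) w * (t * w l)) =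
      ((β l * ‖mono β w‖ ^ 2 : ℝ) : ℂ) * t := by
  by_cases hl : β l = 0
  · simp [hl]
  push_cast
  rw [← Complex.conj_mul', ← mono_sub_single_mul hl]
  ring

theorem norm_conj_mono_mul_natCast_mul_mono_sub_single (β : Fin n → ℕ) (w : Fin n → ℂ)
    (l r : Fin n) (t : ℂ) :
    ‖conj (mono β w) * ((β l : ℂ) * mono (β - Pi.single l 1) w * (t * w r))‖ =
      β l * ‖t‖ * (‖mono β w‖ * ‖mono (β - Pi.single l 1 + Pi.single r 1) w‖) := by
  simp only [norm_mul, Complex.norm_natCast, mono_add, mono_single, Complex.norm_conj]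
  ring

theorem sum_eq_add_sum_Iio_of_eq_zero {M : Type*} [AddCommMonoid M] {r : Fin n} {f : Fin n → M}
    (hf : ∀ l, r < l → f l = 0) : ∑ l, f l = f r + ∑ l ∈ Finset.Iio r, f l := by
  rw [← Finset.sum_subset (Finset.subset_univ (Finset.Iic r)) fun l _ hl =>
    hf l (by simpa using hl), Finset.Iic_eq_cons_Iio, Finset.sum_cons]

theorem sum_card_Iio (n : ℕ) : ∑ r : Fin n, (Finset.Iio r).card = n.choose 2 := by
  simp_rw [Fin.card_Iio]
  rw [Fin.sum_univ_eq_sum_range (fun i => i), Finset.sum_range_id, Nat.choose_two_right]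

section LinearPart

variable {T : Matrix (Fin n) (Fin n) ℂ} {d : Fin n → ℝ≥0} {θ : ℝ≥0}

theorem IsDiagDominated.re_conj_mono_mul_monoDeriv_mulVec_le (hT : IsDiagDominated T d θ)
    (β : Fin n → ℕ) (w : Fin n → ℂ) :
    (conj (mono β w) * monoDeriv β w (T.mulVec w)).re ≤
      -(diagWeight d β * ‖mono β w‖ ^ 2) + upperCross T β w := by
  set f : Fin n → Fin n → ℂ := fun l r =>
    conj (mono β w) * ((β l : ℂ) * mono (β - Pi.single l 1) w * (T l r * w r)) with hf
  have hlower (l r : Fin n) (hrl : r < l) : f l r = 0 := by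
    have hT0 : T l r = 0 := hT.blockTriangular (show id r < id l from hrl)
    simp [hf, hT0]
  have hdiag (r : Fin n) : (f r r).re = -(β r * d r * ‖mono β w‖ ^ 2) := by
    rw [show f r r = _ from conj_mono_mul_natCast_mul_mono_sub_single β w r (T r r),
      Complex.re_ofReal_mul, hT.re_diag]
    ring
  have hrow (r : Fin n) : (∑ l, f l r).re ≤ -(β r * d r * ‖mono β w‖ ^ 2) +
      ∑ l ∈ Finset.Iio r,
        β l * ‖T l r‖ * (‖mono β w‖ * ‖mono (β - Pi.single l 1 + Pi.single r 1) w‖) := by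
    rw [sum_eq_add_sum_Iio_of_eq_zero (hlower · r), Complex.add_re, hdiag, Complex.re_sum]
    gcongr with l _
    exact (Complex.re_le_norm _).trans_eq
      (norm_conj_mono_mul_natCast_mul_mono_sub_single β w l r (T l r))
  calc (conj (mono β w) * monoDeriv β w (T.mulVec w)).re
      = ∑ r, (∑ l, f l r).re := by
        rw [← Complex.re_sum, Finset.sum_comm, monoDeriv_apply, Finset.mul_sum]
        simp only [hf, Matrix.mulVec, dotProduct, Finset.mul_sum]
    _ ≤ _ := Finset.sum_le_sum fun r _ => hrow r
    _ = _ := by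
        rw [Finset.sum_add_distrib, Finset.sum_neg_distrib, ← Finset.sum_mul]
        simp [diagWeight, upperCross]

theorem IsDiagDominated.re_conj_mono_mul_monoDeriv_mulVec_add_le (hT : IsDiagDominated T d θ)
    (H : (Fin n → ℂ) → Fin n → ℂ) (β : Fin n → ℕ) (w : Fin n → ℂ) :
    (conj (mono β w) * monoDeriv β w (T.mulVec w + H w)).re ≤
      -(diagWeight d β * ‖mono β w‖ ^ 2) + upperCross T β w +
        ‖mono β w‖ * ‖koopmanGenerator H (mono β) w‖ := by
  rw [map_add, mul_add, Complex.add_re]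
  gcongr
  · exact hT.re_conj_mono_mul_monoDeriv_mulVec_le β w
  · exact (Complex.re_le_norm _).trans_eq
      (by rw [norm_mul, Complex.norm_conj, koopmanGenerator_mono])

theorem sq_natCast_add_one_mul_le {q r : Fin n} {t : ℝ≥0} (hsq : t ^ 2 ≤ θ ^ 2 * (d q * d r))
    (ht : t ≤ θ * d q) (η : Fin n → ℕ) :
    ((η q + 1) * t) ^ 2 ≤
      θ ^ 2 * (diagWeight d (η + Pi.single q 1) * diagWeight d (η + Pi.single r 1)) := by
  have hD := mul_le_diagWeight d η q
  calc ((η q + 1) * t) ^ 2 = (η q + 1) * (η q * t ^ 2 + t ^ 2) := by ring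
    _ ≤ (η q + 1) * (η q * (θ * d q) ^ 2 + θ ^ 2 * (d q * d r)) := by gcongr
    _ = θ ^ 2 * ((η q * d q + d q) * (η q * d q + d r)) := by ring
    _ ≤ θ ^ 2 * ((diagWeight d η + d q) * (diagWeight d η + d r)) := by gcongr
    _ = _ := by simp only [diagWeight_add_single]

theorem natCast_add_one_mul_mul_le {q r : Fin n} {t : ℝ≥0} (hsq : t ^ 2 ≤ θ ^ 2 * (d q * d r))
    (ht : t ≤ θ * d q) (η : Fin n → ℕ) (x y : ℝ≥0) :
    (η q + 1) * t * (x * y) ≤ θ / 2 * (diagWeight d (η + Pi.single q 1) * x ^ 2 +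
      diagWeight d (η + Pi.single r 1) * y ^ 2) := by
  refine le_half_mul_add_of_sq_le ?_
  calc ((η q + 1) * t * (x * y)) ^ 2 = ((η q + 1) * t) ^ 2 * (x * y) ^ 2 := mul_pow _ _ _
    _ ≤ θ ^ 2 * (diagWeight d (η + Pi.single q 1) * diagWeight d (η + Pi.single r 1)) *
        (x * y) ^ 2 := by
        gcongr
        exact sq_natCast_add_one_mul_le hsq ht η
    _ = _ := by ring

theorem tsum_linear_entry_le {q r : Fin n} {t : ℝ≥0} (hsq : t ^ 2 ≤ θ ^ 2 * (d q * d r))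
    (ht : t ≤ θ * d q) (ε : ℕ → ℝ≥0) (x : (Fin n → ℕ) → ℝ≥0) :
    ∑' β, ((ε (deg β) * (β q * t * (x β * x (β - Pi.single q 1 + Pi.single r 1))) : ℝ≥0) : ℝ≥0∞) ≤
      θ * ∑' β, ((ε (deg β) * (diagWeight d β * x β ^ 2) : ℝ≥0) : ℝ≥0∞) := by
  set y : (Fin n → ℕ) → ℝ≥0 := fun β => ε (deg β) * (diagWeight d β * x β ^ 2) with hy
  have hshift (l : Fin n) : ∑' η, (y (η + Pi.single l 1) : ℝ≥0∞) ≤ ∑' β, (y β : ℝ≥0∞) :=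
    ENNReal.tsum_comp_le_tsum_of_injective (add_left_injective (Pi.single l 1 : Fin n → ℕ))
      fun β => (y β : ℝ≥0∞)
  have hterm (η : Fin n → ℕ) : ε (deg (η + Pi.single q 1)) *
      ((η + Pi.single q 1 : Fin n → ℕ) q * t * (x (η + Pi.single q 1) *
        x (η + Pi.single q 1 - Pi.single q 1 + Pi.single r 1))) ≤
      θ / 2 * y (η + Pi.single q 1) + θ / 2 * y (η + Pi.single r 1) := by
    simp only [hy, deg_add, deg_single, add_tsub_cancel_right, Pi.add_apply, Pi.single_eq_same,
      Nat.cast_add, Nat.cast_one]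
    calc _ ≤ ε (deg η + 1) * (θ / 2 * (_ + _)) :=
          mul_le_mul_of_nonneg_left (natCast_add_one_mul_mul_le hsq ht η _ _) zero_le
      _ = _ := by ring
  rw [← (add_left_injective (Pi.single q 1 : Fin n → ℕ)).tsum_eq fun β hβ =>
    ⟨β - Pi.single q 1, sub_single_add_single fun h => hβ (by simp [h])⟩]
  calc _ ≤ ∑' η, ((θ / 2 : ℝ≥0) * (y (η + Pi.single q 1) : ℝ≥0∞) +
        (θ / 2 : ℝ≥0) * (y (η + Pi.single r 1) : ℝ≥0∞)) :=
        ENNReal.tsum_le_tsum fun η => by exact_mod_cast hterm η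
    _ = (θ / 2 : ℝ≥0) * ∑' η, (y (η + Pi.single q 1) : ℝ≥0∞) +
        (θ / 2 : ℝ≥0) * ∑' η, (y (η + Pi.single r 1) : ℝ≥0∞) := by
        rw [ENNReal.tsum_add, ENNReal.tsum_mul_left, ENNReal.tsum_mul_left]
    _ ≤ (θ / 2 : ℝ≥0) * ∑' β, (y β : ℝ≥0∞) + (θ / 2 : ℝ≥0) * ∑' β, (y β : ℝ≥0∞) :=
        add_le_add (mul_le_mul_of_nonneg_left (hshift q) zero_le)
          (mul_le_mul_of_nonneg_left (hshift r) zero_le)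
    _ = θ * ∑' β, (y β : ℝ≥0∞) := by
        rw [← add_mul, ← ENNReal.coe_add, add_halves]

theorem IsDiagDominated.tsum_upperCross_le (hT : IsDiagDominated T d θ) (ε : ℕ → ℝ≥0)
    (w : Fin n → ℂ) :
    ∑' β, ((ε (deg β) * upperCross T β w : ℝ≥0) : ℝ≥0∞) ≤
      (n.choose 2 * θ : ℝ≥0) *
        ∑' β, ((ε (deg β) * (diagWeight d β * ‖mono β w‖₊ ^ 2) : ℝ≥0) : ℝ≥0∞) := by
  set Y := ∑' β, ((ε (deg β) * (diagWeight d β * ‖mono β w‖₊ ^ 2) : ℝ≥0) : ℝ≥0∞)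
  calc ∑' β, ((ε (deg β) * upperCross T β w : ℝ≥0) : ℝ≥0∞)
      = ∑ r, ∑ l ∈ Finset.Iio r, ∑' β : Fin n → ℕ, ((ε (deg β) * (β l * ‖T l r‖₊ *
          (‖mono β w‖₊ * ‖mono (β - Pi.single l 1 + Pi.single r 1) w‖₊)) : ℝ≥0) : ℝ≥0∞) := by
        simp_rw [← Summable.tsum_finsetSum fun _ _ => ENNReal.summable, upperCross,
          Finset.mul_sum, ENNReal.ofNNReal_finsetSum]
    _ ≤ ∑ r : Fin n, (Finset.Iio r).card • (θ * Y) := by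
        refine Finset.sum_le_sum fun r _ => Finset.sum_le_card_nsmul _ _ _ fun l hl => ?_
        have hlr : l < r := Finset.mem_Iio.1 hl
        exact tsum_linear_entry_le (hT.sq_nnnorm_le l r hlr) (hT.nnnorm_le l r hlr) ε
          fun β => ‖mono β w‖₊
    _ = (n.choose 2 * θ : ℝ≥0) * Y := by
        rw [Finset.sum_nsmul_assoc, sum_card_Iio]
        simp [mul_assoc]

end LinearPart

/-- The absolute sum of row `β` of the Koopman matrix, in `ℝ≥0` (so `0` if it is infinite). -/
noncomputable def koopmanRow (b : Fin n → (Fin n → ℕ) → ℂ) (β : Fin n → ℕ) : ℝ≥0 :=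
  ∑' γ, ‖koopmanCoeff b β γ‖₊

/-- The absolute sum of column `γ` of the Koopman matrix, in `ℝ≥0` (so `0` if it is infinite). -/
noncomputable def koopmanCol (b : Fin n → (Fin n → ℕ) → ℂ) (γ : Fin n → ℕ) : ℝ≥0 :=
  ∑' β, ‖koopmanCoeff b β γ‖₊

/-- The weights `ε` grow fast enough for the Schur test to bound the degree-raising entries of the
Koopman matrix by `κ` times its diagonal. -/
def IsSchurWeight (b : Fin n → (Fin n → ℕ) → ℂ) (d : Fin n → ℝ≥0) (κ : ℝ≥0) (ε : ℕ → ℝ≥0) : Prop :=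
  ∀ β γ, deg β < deg γ → koopmanCoeff b β γ ≠ 0 →
    ε (deg β) * (koopmanRow b β * koopmanCol b γ) ≤
      κ ^ 2 * (diagWeight d β * diagWeight d γ) * ε (deg γ)

section HighOrder

variable {b : Fin n → (Fin n → ℕ) → ℂ} {d : Fin n → ℝ≥0} {κ : ℝ≥0} {ε : ℕ → ℝ≥0}

theorem coe_koopmanRow (hsum : ∀ l, ∑' η, ‖b l η‖ₑ ≠ ⊤) (β : Fin n → ℕ) :
    (koopmanRow b β : ℝ≥0∞) = ∑' γ, ‖koopmanCoeff b β γ‖ₑ := by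
  refine ENNReal.coe_tsum (ENNReal.tsum_coe_ne_top_iff_summable.1 ?_)
  refine ne_top_of_le_ne_top ?_ (tsum_enorm_koopmanCoeff_row_le b β)
  exact ENNReal.sum_ne_top.2 fun l _ => ENNReal.mul_ne_top (ENNReal.natCast_ne_top _) (hsum l)

theorem coe_koopmanCol (hb : ∀ l, b l 0 = 0) (γ : Fin n → ℕ) :
    (koopmanCol b γ : ℝ≥0∞) = ∑' β, ‖koopmanCoeff b β γ‖ₑ :=
  ENNReal.coe_tsum (ENNReal.tsum_coe_ne_top_iff_summable.1
    (tsum_enorm_koopmanCoeff_col_ne_top hb γ))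

theorem enorm_koopmanCoeff_highOrder_le (b : Fin n → (Fin n → ℕ) → ℂ) (β γ : Fin n → ℕ) :
    ‖koopmanCoeff (highOrder b) β γ‖ₑ ≤ ‖koopmanCoeff b β γ‖ₑ := by
  rw [koopmanCoeff_highOrder]
  split_ifs <;> simp

theorem enorm_koopmanGenerator_mono_le {s : ℝ} {H : (Fin n → ℂ) → Fin n → ℂ}
    (hH : ∀ l, HasMonoSeries s (fun w => H w l) (b l)) {w : Fin n → ℂ} (hw : ‖w‖ < s)
    (β : Fin n → ℕ) :
    ‖koopmanGenerator H (mono β) w‖ₑ ≤ ∑' γ, ‖koopmanCoeff b β γ‖ₑ * ‖mono γ w‖ₑ := by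
  have hseries := hasMonoSeries_koopmanGenerator hH β w (mem_ball_zero_iff.2 hw)
  rw [← hseries.tsum_eq]
  simpa only [enorm_mul] using
    enorm_tsum_le_tsum_enorm (f := fun γ => koopmanCoeff b β γ * mono γ w)

theorem IsSchurWeight.tsum_highOrder_le (hε : IsSchurWeight b d κ ε) (hb : ∀ l, b l 0 = 0)
    (hsum : ∀ l, ∑' η, ‖b l η‖ₑ ≠ ⊤) {s : ℝ} {H : (Fin n → ℂ) → Fin n → ℂ}
    (hH : ∀ l, HasMonoSeries s (fun w => H w l) (highOrder b l)) {w : Fin n → ℂ} (hw : ‖w‖ < s) :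
    ∑' β, ((ε (deg β) * (‖mono β w‖₊ * ‖koopmanGenerator H (mono β) w‖₊) : ℝ≥0) : ℝ≥0∞) ≤
      κ * ∑' β, ((ε (deg β) * (diagWeight d β * ‖mono β w‖₊ ^ 2) : ℝ≥0) : ℝ≥0∞) := by
  set k : (Fin n → ℕ) → (Fin n → ℕ) → ℝ≥0 := fun β γ => ‖koopmanCoeff (highOrder b) β γ‖₊ with hk
  set u : (Fin n → ℕ) → (Fin n → ℕ) → ℝ≥0 := fun β γ => ε (deg β) * (‖mono β w‖₊ * ‖mono γ w‖₊)
    with hu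
  have hrow (β : Fin n → ℕ) : ∑' γ, (k β γ : ℝ≥0∞) ≤ koopmanRow b β :=
    (ENNReal.tsum_le_tsum fun γ => enorm_koopmanCoeff_highOrder_le b β γ).trans_eq
      (coe_koopmanRow hsum β).symm
  have hcol (γ : Fin n → ℕ) : ∑' β, (k β γ : ℝ≥0∞) ≤ koopmanCol b γ :=
    (ENNReal.tsum_le_tsum fun β => enorm_koopmanCoeff_highOrder_le b β γ).trans_eq
      (coe_koopmanCol hb γ).symm
  refine le_trans (ENNReal.tsum_le_tsum fun β => ?_)
    (tsum_mul_le_of_schur (u := u) hrow hcol fun β γ hne => ?_)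
  · calc ((ε (deg β) * (‖mono β w‖₊ * ‖koopmanGenerator H (mono β) w‖₊) : ℝ≥0) : ℝ≥0∞)
        ≤ ε (deg β) * (‖mono β w‖₊ * ∑' γ, (k β γ : ℝ≥0∞) * ‖mono γ w‖₊) := by
          push_cast
          gcongr
          exact enorm_koopmanGenerator_mono_le hH hw β
      _ = ∑' γ, ((k β γ * u β γ : ℝ≥0) : ℝ≥0∞) := by
          simp_rw [← ENNReal.tsum_mul_left, hu]
          refine tsum_congr fun γ => ?_
          push_cast
          ring
  · rw [hk, nnnorm_ne_zero_iff, koopmanCoeff_highOrder, ite_ne_right_iff] at hne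
    calc u β γ ^ 2 * (koopmanRow b β * koopmanCol b γ)
        = ε (deg β) * (‖mono β w‖₊ * ‖mono γ w‖₊) ^ 2 *
            (ε (deg β) * (koopmanRow b β * koopmanCol b γ)) := by ring
      _ ≤ ε (deg β) * (‖mono β w‖₊ * ‖mono γ w‖₊) ^ 2 *
            (κ ^ 2 * (diagWeight d β * diagWeight d γ) * ε (deg γ)) :=
          mul_le_mul_of_nonneg_left (hε β γ hne.1 hne.2) zero_le
      _ = _ := by ring

end HighOrder

/-- The matrix of the linear part of a vector field with coefficients `b`. -/
def linearPart (b : Fin n → (Fin n → ℕ) → ℂ) : Matrix (Fin n) (Fin n) ℂ :=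
  Matrix.of fun l r => b l (Pi.single r 1)

theorem exists_hasSum_le_of_tsum_coe_le {ι : Type*} {g : ι → ℝ≥0} {a : ℝ≥0}
    (h : ∑' i, (g i : ℝ≥0∞) ≤ a) : ∃ s ≤ a, HasSum g s := by
  have hg : Summable g :=
    ENNReal.tsum_coe_ne_top_iff_summable.1 (ne_top_of_le_ne_top ENNReal.coe_ne_top h)
  exact ⟨_, by rwa [← ENNReal.coe_tsum hg, ENNReal.coe_le_coe] at h, hg.hasSum⟩

theorem lyapunovDeriv_le {G : (Fin n → ℂ) → Fin n → ℂ} {b : Fin n → (Fin n → ℕ) → ℂ}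
    {d : Fin n → ℝ≥0} {θ κ ρ : ℝ≥0} {ε : ℕ → ℝ≥0} (hb : ∀ l, b l 0 = 0)
    (hsum : ∀ l, ∑' η, ‖b l η‖ₑ ≠ ⊤) (hG : ∀ l, HasMonoSeries ρ (fun w => G w l) (b l))
    (hT : IsDiagDominated (linearPart b) d θ) (hschur : IsSchurWeight b d κ ε)
    (hε : IsLyapunovWeight ρ ε) {w : Fin n → ℂ} (hw : ‖w‖ < ρ) :
    lyapunovDeriv ε w (G w) ≤ 2 * (-1 + (n.choose 2 * θ + κ)) * dissipation ε d w := by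
  set H : (Fin n → ℂ) → Fin n → ℂ := fun w l => G w l - ∑ r, b l (Pi.single r 1) * w r with hH
  set Y := dissipation ε d w
  have hY : HasSum (fun β => ε (deg β) * (diagWeight d β * ‖mono β w‖₊ ^ 2)) Y :=
    hε.hasSum_dissipation hw d
  set g : (Fin n → ℕ) → ℝ≥0 := fun β => ε (deg β) * upperCross (linearPart b) β w +
    ε (deg β) * (‖mono β w‖₊ * ‖koopmanGenerator H (mono β) w‖₊)
  obtain ⟨S, hSY, hS⟩ : ∃ S ≤ (n.choose 2 * θ + κ) * Y, HasSum g S := by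
    refine exists_hasSum_le_of_tsum_coe_le ?_
    simp only [g, ENNReal.coe_add, ENNReal.tsum_add]
    rw [add_mul, ENNReal.coe_add, ENNReal.coe_mul (n.choose 2 * θ), ENNReal.coe_mul κ, ← hY.tsum_eq,
      ENNReal.coe_tsum hY.summable]
    exact add_le_add (hT.tsum_upperCross_le ε w)
      (hschur.tsum_highOrder_le hb hsum (fun l => HasMonoSeries.sub_linear hb hG l) hw)
  have hGw : G w = (linearPart b).mulVec w + H w := by
    funext l
    simp [hH, linearPart, Matrix.mulVec, dotProduct]
  have hterm (β : Fin n → ℕ) : (ε (deg β) : ℝ) * (2 * (conj (mono β w) *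
      monoDeriv β w (G w)).re) ≤
      2 * (-((ε (deg β) * (diagWeight d β * ‖mono β w‖₊ ^ 2) : ℝ≥0) : ℝ) + g β) := by
    have hscaled := mul_le_mul_of_nonneg_left
      (hT.re_conj_mono_mul_monoDeriv_mulVec_add_le H β w) (ε (deg β)).coe_nonneg
    rw [hGw]
    push_cast [g]
    linarith
  have hle := hasSum_le hterm (hε.hasSum_lyapunovDeriv hw (G w))
    (((NNReal.hasSum_coe.2 hY).neg.add (NNReal.hasSum_coe.2 hS)).mul_left (2 : ℝ))
  calc lyapunovDeriv ε w (G w) ≤ 2 * (-Y + S) := hle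
    _ ≤ 2 * (-Y + (n.choose 2 * θ + κ) * Y) := by
        gcongr
        exact_mod_cast hSY
    _ = _ := by ring

/-! ### Trajectories of switched systems -/

section Trajectory

variable {m : ℕ} {E : Type*} [NormedAddCommGroup E] [NormedSpace ℝ E] {σ : ℝ → Fin m}
  {F : Fin m → E → E} {X : Set E} {x : ℝ → E}

theorem IsCommutationLaw.exists_forall_continuousAt (hσ : IsCommutationLaw σ) (t : ℝ) :
    ∃ δ > 0, ∀ s, 0 < s → dist s t < δ → s ≠ t → ContinuousAt σ s := by
  have hfin := (hσ (t + 1)).subset (sdiff_subset (t := {t}))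
  have hmem : ({s : ℝ | 0 < s ∧ s ≤ t + 1 ∧ ¬ ContinuousAt σ s} \ {t})ᶜ ∈ 𝓝 t :=
    hfin.isClosed.isOpen_compl.mem_nhds fun h => h.2 rfl
  obtain ⟨δ, hδ, hball⟩ := Metric.mem_nhds_iff.1 hmem
  refine ⟨min δ 1, lt_min hδ one_pos, fun s hs hst hne => ?_⟩
  by_contra hc
  have hs_lt : s < t + 1 := by
    have := (le_abs_self _).trans_lt (hst.trans_le (min_le_right _ _))
    linarith
  exact hball (Metric.mem_ball.2 (hst.trans_le (min_le_left _ _))) ⟨⟨hs, hs_lt.le, hc⟩, hne⟩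

theorem exists_eqOn_const_Ioo {a b : ℝ} (hab : a < b)
    (h : ∀ s ∈ Ioo a b, ContinuousAt σ s) : ∃ i, ∀ s ∈ Ioo a b, σ s = i := by
  obtain ⟨c, hc⟩ := nonempty_Ioo.2 hab
  exact ⟨σ c, fun s hs => isPreconnected_Ioo.constant
    (fun s hs => (h s hs).continuousWithinAt) hs hc⟩

theorem IsCommutationLaw.exists_right (hσ : IsCommutationLaw σ) {t : ℝ} (ht : 0 ≤ t) :
    ∃ b > t, ∃ i, ∀ s ∈ Ioo t b, ContinuousAt σ s ∧ σ s = i := by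
  obtain ⟨δ, hδ, h⟩ := hσ.exists_forall_continuousAt t
  have hcont : ∀ s ∈ Ioo t (t + δ), ContinuousAt σ s := fun s hs =>
    h s (ht.trans_lt hs.1) (by rw [Real.dist_eq, abs_of_pos] <;> linarith [hs.1, hs.2]) hs.1.ne'
  obtain ⟨i, hi⟩ := exists_eqOn_const_Ioo (by linarith) hcont
  exact ⟨t + δ, by linarith, i, fun s hs => ⟨hcont s hs, hi s hs⟩⟩

theorem IsCommutationLaw.exists_left (hσ : IsCommutationLaw σ) {t : ℝ} (ht : 0 < t) :
    ∃ a, 0 ≤ a ∧ a < t ∧ ∃ i, ∀ s ∈ Ioo a t, ContinuousAt σ s ∧ σ s = i := by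
  obtain ⟨δ, hδ, h⟩ := hσ.exists_forall_continuousAt t
  have hcont : ∀ s ∈ Ioo (max 0 (t - δ)) t, ContinuousAt σ s := fun s hs => by
    obtain ⟨hs0, hsδ⟩ := max_lt_iff.1 hs.1
    exact h s hs0 (by rw [Real.dist_eq, abs_of_neg] <;> linarith [hs.2]) hs.2.ne
  have hlt : max 0 (t - δ) < t := max_lt ht (by linarith)
  obtain ⟨i, hi⟩ := exists_eqOn_const_Ioo hlt hcont
  exact ⟨_, le_max_left _ _, hlt, i, fun s hs => ⟨hcont s hs, hi s hs⟩⟩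

theorem IsTrajectory.hasDerivAt_of_mem_Ioo (hx : IsTrajectory F X σ x) {a b t : ℝ} (ha : 0 ≤ a)
    {i : Fin m} (hi : ∀ s ∈ Ioo a b, ContinuousAt σ s ∧ σ s = i) (ht : t ∈ Ioo a b) :
    HasDerivAt x (F i (x t)) t :=
  (hi t ht).2 ▸ hx.hasDerivAt t (ha.trans_lt ht.1) (hi t ht).1

theorem IsTrajectory.hasDerivWithinAt_Ici (hF : ∀ i, ContinuousOn (F i) X)
    (hx : IsTrajectory F X σ x) {a b : ℝ} (ha : 0 ≤ a) (hab : a < b) {i : Fin m}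
    (hi : ∀ s ∈ Ioo a b, ContinuousAt σ s ∧ σ s = i) :
    HasDerivWithinAt x (F i (x a)) (Ici a) a := by
  have hderiv := fun s => hx.hasDerivAt_of_mem_Ioo (t := s) ha hi
  have hmem : Ioo a b ∈ 𝓝[>] a := Ioo_mem_nhdsGT hab
  have hcont : ContinuousWithinAt x (Ioo a b) a :=
    (hx.continuousOn a ha).mono fun s hs => ha.trans hs.1.le
  refine hasDerivWithinAt_Ici_of_tendsto_deriv
    (fun s hs => (hderiv s hs).differentiableAt.differentiableWithinAt) hcont hmem ?_
  have hlim : Tendsto (fun s => F i (x s)) (𝓝[Ioo a b] a) (𝓝 (F i (x a))) :=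
    (hF i (x a) (hx.mem a ha)).tendsto.comp (tendsto_nhdsWithin_iff.2 ⟨hcont.tendsto, by
      filter_upwards [self_mem_nhdsWithin] with s hs using hx.mem s (ha.trans hs.1.le)⟩)
  rw [nhdsWithin_Ioo_eq_nhdsGT hab] at hlim
  refine hlim.congr' ?_
  filter_upwards [hmem] with s hs using (hderiv s hs).deriv.symm

end Trajectory

section Flow

variable {m : ℕ} {σ : ℝ → Fin m} {F : Fin m → (Fin n → ℂ) → Fin n → ℂ} {X : Set (Fin n → ℂ)}
  {x : ℝ → Fin n → ℂ}

theorem IsHolomorphicFlow.hasDerivWithinAt_sub {G : (Fin n → ℂ) → Fin n → ℂ}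
    {φ : ℝ → (Fin n → ℂ) → Fin n → ℂ} (hφ : IsHolomorphicFlow G X φ) {z : Fin n → ℂ} (hz : z ∈ X)
    {a t : ℝ} (hat : a ≤ t) :
    HasDerivWithinAt (fun s => φ (s - a) z) (G (φ (t - a) z)) (Ici a) t := by
  have hshift : HasDerivWithinAt (fun s : ℝ => s - a) 1 (Ici a) t :=
    (hasDerivWithinAt_id t _).sub_const a
  simpa only [one_smul, Function.comp_def] using
    (hφ.hasDerivWithinAt z hz (t - a) (sub_nonneg.2 hat)).scomp t hshift
      fun s (hs : a ≤ s) => sub_nonneg.2 hs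

theorem IsTrajectory.eq_flow (hF : ∀ i, LocallyLipschitzOn X (F i)) (hx : IsTrajectory F X σ x)
    {i : Fin m} {φ : ℝ → (Fin n → ℂ) → Fin n → ℂ} (hφ : IsHolomorphicFlow (F i) X φ)
    {a b : ℝ} (ha : 0 ≤ a) (hab : a < b) (hi : ∀ s ∈ Ioo a b, ContinuousAt σ s ∧ σ s = i) :
    x b = φ (b - a) (x a) := by
  have hxa := hx.mem a ha
  have hxc : ContinuousOn x (Icc a b) := hx.continuousOn.mono fun s hs => ha.trans hs.1
  have hφc : ContinuousOn (fun s => φ (s - a) (x a)) (Icc a b) := fun t ht =>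
    (hφ.hasDerivWithinAt_sub hxa ht.1).continuousWithinAt.mono Icc_subset_Ici_self
  set S := x '' Icc a b ∪ (fun s => φ (s - a) (x a)) '' Icc a b
  have hSX : S ⊆ X := union_subset (image_subset_iff.2 fun t ht => hx.mem t (ha.trans ht.1))
    (image_subset_iff.2 fun t ht => hφ.mapsTo (t - a) (sub_nonneg.2 ht.1) hxa)
  obtain ⟨K, hK⟩ := ((hF i).mono hSX).exists_lipschitzOnWith_of_compact
    ((isCompact_Icc.image_of_continuousOn hxc).union (isCompact_Icc.image_of_continuousOn hφc))
  refine ODE_solution_unique_of_mem_Icc_right (v := fun _ => F i) (s := fun _ => S)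
    (fun _ _ => hK) hxc (fun t ht => ?_)
    (fun t ht => .inl (mem_image_of_mem _ (Ico_subset_Icc_self ht))) hφc
    (fun t ht => (hφ.hasDerivWithinAt_sub hxa ht.1).mono (Ici_subset_Ici.2 ht.1))
    (fun t ht => .inr ⟨t, Ico_subset_Icc_self ht, rfl⟩) ?_ (right_mem_Icc.2 hab.le)
  · rcases ht.1.eq_or_lt with rfl | hat
    · exact hx.hasDerivWithinAt_Ici (fun i => (hF i).continuousOn) ha hab hi
    · exact (hx.hasDerivAt_of_mem_Ioo ha hi ⟨hat, ht.2⟩).hasDerivWithinAt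
  · simp only [sub_self, hφ.map_zero _ hxa]

theorem IsTrajectory.mem_of_isForwardInvariant (hF : ∀ i, LocallyLipschitzOn X (F i))
    (hσ : IsCommutationLaw σ) (hx : IsTrajectory F X σ x)
    {φ : Fin m → ℝ → (Fin n → ℂ) → Fin n → ℂ} (hφ : ∀ i, IsHolomorphicFlow (F i) X (φ i))
    {U : Set (Fin n → ℂ)} (hU : IsOpen U) (hinv : ∀ i, IsForwardInvariant (φ i) U)
    (h0 : x 0 ∈ U) {t : ℝ} (ht : 0 ≤ t) : x t ∈ U := by
  by_contra hc
  set exitTimes : Set ℝ := Ici 0 ∩ x ⁻¹' Uᶜ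
  have hclosed : IsClosed exitTimes :=
    hx.continuousOn.preimage_isClosed_of_isClosed isClosed_Ici hU.isClosed_compl
  have hbdd : BddBelow exitTimes := ⟨0, fun s hs => hs.1⟩
  have hmem : sInf exitTimes ∈ exitTimes := hclosed.csInf_mem ⟨t, ht, hc⟩ hbdd
  have hpos : 0 < sInf exitTimes := hmem.1.lt_of_ne fun h => hmem.2 (h ▸ h0)
  obtain ⟨a, ha, hat, i, hi⟩ := hσ.exists_left hpos
  have hxa : x a ∈ U := by
    by_contra hxa
    exact hat.not_ge (csInf_le hbdd ⟨ha, hxa⟩)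
  refine hmem.2 ?_
  rw [hx.eq_flow hF (hφ i) ha hat hi]
  exact hinv i (by linarith) hxa

theorem HasMonoSeries.locallyLipschitzOn {G : (Fin n → ℂ) → Fin n → ℂ} {s : ℝ}
    {a : Fin n → (Fin n → ℕ) → ℂ} (h : ∀ l, HasMonoSeries s (fun z => G z l) (a l)) :
    LocallyLipschitzOn (Metric.ball 0 s) G := by
  intro z hz
  obtain ⟨r, hzr, hrs⟩ := exists_between (mem_ball_zero_iff.1 hz)
  choose K hK using fun l => (h l).exists_lipschitzOnWith hrs
  refine ⟨∑ l, K l, _, mem_nhdsWithin_of_mem_nhds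
    (Metric.isOpen_ball.mem_nhds (mem_ball_zero_iff.2 hzr)),
    LipschitzOnWith.of_dist_le_mul fun x hx y hy => ?_⟩
  refine (dist_pi_le_iff (by positivity)).2 fun l => ((hK l).dist_le_mul x hx y hy).trans ?_
  gcongr
  exact Finset.single_le_sum (fun _ _ => zero_le) (Finset.mem_univ l)

end Flow

/-! ### Stability from a Lyapunov function -/

theorem le_mul_exp_of_hasDerivWithinAt {V : ℝ → ℝ} {c : ℝ} (hV : ContinuousOn V (Ici 0))
    (hd : ∀ t, 0 ≤ t → ∃ V', HasDerivWithinAt V V' (Ici t) t ∧ V' ≤ -c * V t) {t : ℝ}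
    (ht : 0 ≤ t) : V t ≤ V 0 * Real.exp (-c * t) := by
  choose! V' hderiv hle using hd
  have hgronwall := le_gronwallBound_of_liminf_deriv_right_le (δ := V 0) (ε := 0)
    (hV.mono Icc_subset_Ici_self) (fun s hs r => (hderiv s hs.1).liminf_right_slope_le) le_rfl
    (fun s hs => (hle s hs.1).trans_eq (add_zero _).symm) t (right_mem_Icc.2 ht)
  rwa [gronwallBound_ε0, sub_zero] at hgronwall

theorem exists_pos_forall_le {ι R : Type*} [Finite ι] [LinearOrder R] [Zero R] [NoMaxOrder R]
    {f : ι → R} (hf : ∀ i, 0 < f i) : ∃ s > 0, ∀ i, s ≤ f i := by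
  obtain ⟨⟨s, hs⟩, hle⟩ := Finite.exists_ge fun i => (⟨f i, hf i⟩ : Ioi (0 : R))
  exact ⟨s, hs, hle⟩

theorem tendsto_zero_of_mul_sq_norm_le_exp {E : Type*} [NormedAddCommGroup E] {x : ℝ → E}
    {e c C : ℝ} (he : 0 < e) (hc : 0 < c)
    (h : ∀ t, 0 ≤ t → e * ‖x t‖ ^ 2 ≤ C * Real.exp (-c * t)) : Tendsto x atTop (𝓝 0) := by
  have hexp : Tendsto (fun t : ℝ => Real.exp (-c * t)) atTop (𝓝 0) :=
    Real.tendsto_exp_atBot.comp (tendsto_id.const_mul_atTop_of_neg (neg_lt_zero.2 hc))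
  have hsqrt : Tendsto (fun t : ℝ => √(C * Real.exp (-c * t) / e)) atTop (𝓝 0) := by
    simpa using ((hexp.const_mul C).div_const e).sqrt
  refine squeeze_zero_norm' ?_ hsqrt
  filter_upwards [eventually_ge_atTop 0] with t ht
  refine Real.le_sqrt_of_sq_le ?_
  rw [le_div_iff₀ he, mul_comm]
  exact h t ht

theorem isGUAS_of_lyapunov {m : ℕ} {E : Type*} [NormedAddCommGroup E] [NormedSpace ℝ E]
    {F : Fin m → E → E} {X D : Set E} {V : E → ℝ} {e c : ℝ} (hD : D ∈ 𝓝 0)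
    (hF0 : ∀ i, F i 0 = 0) (he : 0 < e) (hc : 0 < c) (hV0 : V 0 = 0) (hVc : ContinuousAt V 0)
    (hV : ∀ σ x, IsCommutationLaw σ → IsTrajectory F X σ x → x 0 ∈ D →
      ∀ t, 0 ≤ t → e * ‖x t‖ ^ 2 ≤ V (x 0) * Real.exp (-c * t)) : IsGUAS F X 0 D := by
  have hlim : ∀ σ x, IsCommutationLaw σ → IsTrajectory F X σ x → x 0 ∈ D →
      Tendsto x atTop (𝓝 0) := fun σ x hσ hx h0 =>
    tendsto_zero_of_mul_sq_norm_le_exp he hc (hV σ x hσ hx h0)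
  refine ⟨⟨hF0, fun ε hε => ?_⟩, hlim⟩
  have hsmall : ∀ᶠ z in 𝓝 (0 : E), V z < e * ε ^ 2 :=
    hVc.eventually_lt_const (by rw [hV0]; positivity)
  obtain ⟨δ, hδ, hball⟩ := Metric.nhds_basis_closedBall.eventually_iff.1
    (hsmall.and (eventually_mem_set.2 hD))
  refine ⟨δ, hδ, fun σ x hσ hx h0 t ht => ?_, fun σ x hσ hx h0 =>
    hlim σ x hσ hx (hball (mem_closedBall_iff_norm.2 h0)).2⟩
  obtain ⟨hVε, hxD⟩ := hball (mem_closedBall_iff_norm.2 h0)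
  have hV_nonneg : 0 ≤ V (x 0) := by
    have hzero := hV σ x hσ hx hxD 0 le_rfl
    rw [mul_zero, Real.exp_zero, mul_one] at hzero
    exact (by positivity : 0 ≤ e * ‖x 0‖ ^ 2).trans hzero
  have hexp : Real.exp (-c * t) ≤ 1 := Real.exp_le_one_iff.2 (by nlinarith)
  rw [sub_zero]
  refine le_of_sq_le_sq (le_of_mul_le_mul_left ?_ he) hε.le
  calc e * ‖x t‖ ^ 2 ≤ V (x 0) * Real.exp (-c * t) := hV σ x hσ hx hxD t ht.le
    _ ≤ V (x 0) := mul_le_of_le_one_right hV_nonneg hexp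
    _ ≤ e * ε ^ 2 := hVε.le

/-! ### Linear changes of coordinates -/

theorem exists_hasMonoSeries_changeCoord {F : (Fin n → ℂ) → Fin n → ℂ}
    (hF : ∀ l, HasSummableTaylor fun z => F z l) (P : Matrix (Fin n) (Fin n) ℂ) :
    ∃ s > 0, ∃ b : Fin n → (Fin n → ℕ) → ℂ,
      ∀ l, HasMonoSeries s (fun w => changeCoord P F w l) (b l) := by
  choose r hr a ha using fun k => (hF k).exists_hasMonoSeries_comp_mulVec P
  obtain ⟨s, hs, hsr⟩ := exists_pos_forall_le hr
  exact ⟨s, hs, fun l β => ∑ k, P⁻¹ l k * a k β, fun l =>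
    HasMonoSeries.sum Finset.univ fun k _ => ((ha k).of_le (hsr k)).const_mul (P⁻¹ l k)⟩

theorem linearPart_eq_jacobian {G : (Fin n → ℂ) → Fin n → ℂ} {s : ℝ} (hs : 0 < s)
    {b : Fin n → (Fin n → ℕ) → ℂ} (hG : ∀ l, HasMonoSeries s (fun w => G w l) (b l)) :
    linearPart b = jacobian G 0 := by
  ext l r
  have hdiff : DifferentiableAt ℂ G 0 :=
    differentiableAt_pi.2 fun j => (hG j).differentiableAt (Metric.mem_ball_self hs)
  rw [linearPart, Matrix.of_apply, ← (hG l).fderiv_zero_single hs,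
    (hasFDerivAt_pi'.1 hdiff.hasFDerivAt l).fderiv, jacobian, LinearMap.toMatrix'_apply]
  rfl

theorem jacobian_changeCoord {F : (Fin n → ℂ) → Fin n → ℂ} (hF : DifferentiableAt ℂ F 0)
    (P : Matrix (Fin n) (Fin n) ℂ) :
    jacobian (changeCoord P F) 0 = P⁻¹ * jacobian F 0 * P := by
  set A := (Matrix.toLin' P⁻¹).toContinuousLinearMap
  set B := (Matrix.toLin' P).toContinuousLinearMap
  have hderiv : HasFDerivAt (changeCoord P F) (A.comp ((fderiv ℂ F 0).comp B)) 0 := by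
    have hFB : HasFDerivAt F (fderiv ℂ F 0) (B 0) := by
      rw [map_zero]
      exact hF.hasFDerivAt
    exact A.hasFDerivAt.comp 0 (hFB.comp 0 B.hasFDerivAt)
  have hcoe : (A.comp ((fderiv ℂ F 0).comp B) : (Fin n → ℂ) →ₗ[ℂ] Fin n → ℂ) =
      Matrix.toLin' P⁻¹ ∘ₗ (fderiv ℂ F 0 : (Fin n → ℂ) →ₗ[ℂ] Fin n → ℂ) ∘ₗ Matrix.toLin' P := rfl
  rw [jacobian, hderiv.fderiv, hcoe, LinearMap.toMatrix'_comp, LinearMap.toMatrix'_comp,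
    LinearMap.toMatrix'_toLin', LinearMap.toMatrix'_toLin', jacobian, mul_assoc]

theorem apply_self_mem_spectrum_of_blockTriangular {ι K : Type*} [Fintype ι] [LinearOrder ι]
    [Field K] {T : Matrix ι ι K} (hT : T.BlockTriangular id) (l : ι) : T l l ∈ spectrum K T := by
  refine Matrix.mem_spectrum_of_isRoot_charpoly ?_
  rw [Matrix.charpoly_of_isUpperTriangular T hT, Polynomial.IsRoot, Polynomial.eval_prod]
  exact Finset.prod_eq_zero (Finset.mem_univ l) (by simp)

theorem spectrum_inv_mul_mul {ι K : Type*} [Fintype ι] [DecidableEq ι] [Field K]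
    {P : Matrix ι ι K} (hP : IsUnit P.det) (A : Matrix ι ι K) :
    spectrum K (P⁻¹ * A * P) = spectrum K A :=
  spectrum.units_conjugate' (u := P.nonsingInvUnit hP)

theorem IsHyperbolicStableAtZero.re_inv_mul_jacobian_mul_apply_self_neg
    {F : (Fin n → ℂ) → Fin n → ℂ} (hF : IsHyperbolicStableAtZero F)
    {P : Matrix (Fin n) (Fin n) ℂ} (hP : IsUnit P.det)
    (htri : (P⁻¹ * jacobian F 0 * P).BlockTriangular id) (l : Fin n) :
    ((P⁻¹ * jacobian F 0 * P) l l).re < 0 :=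
  hF.2 _ (spectrum_inv_mul_mul hP (jacobian F 0) ▸
    apply_self_mem_spectrum_of_blockTriangular htri l)

theorem changeCoord_zero {F : (Fin n → ℂ) → Fin n → ℂ} (hF : F 0 = 0)
    (P : Matrix (Fin n) (Fin n) ℂ) : changeCoord P F 0 = 0 := by
  rw [changeCoord, Matrix.mulVec_zero, hF, Matrix.mulVec_zero]

/-- The vector field whose components have the Taylor coefficients `b l`. It continues a vector
field known only near `0` to the unit polydisk. -/
noncomputable def seriesField (b : Fin n → (Fin n → ℕ) → ℂ) (w : Fin n → ℂ) : Fin n → ℂ :=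
  fun l => ∑' η, b l η * mono η w

theorem hasMonoSeries_seriesField {b : Fin n → (Fin n → ℕ) → ℂ}
    (hsum : ∀ l, ∑' η, ‖b l η‖ₑ ≠ ⊤) (l : Fin n) :
    HasMonoSeries 1 (fun w => seriesField b w l) (b l) := by
  refine fun w hw => (Summable.of_enorm (ne_top_of_le_ne_top (hsum l) ?_)).hasSum
  refine ENNReal.tsum_le_tsum fun η => ?_
  rw [enorm_mul]
  refine mul_le_of_le_one_right' ?_
  simpa using enorm_mono_le η (s := 1) (mem_ball_zero_iff.1 hw).le

theorem HasMonoSeries.eq_of_differentiableOn {f g : (Fin n → ℂ) → ℂ} {s R : ℝ} (hs : 0 < s)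
    {b : (Fin n → ℕ) → ℂ} (hf : HasMonoSeries s f b) (hg : HasMonoSeries R g b)
    {w : Fin n → ℂ} {r : ℝ} (hr : 1 < r) (hw : ∀ τ ∈ Metric.ball (0 : ℂ) r, ‖τ • w‖ < R)
    (hfd : DifferentiableOn ℂ (fun τ : ℂ => f (τ • w)) (Metric.ball 0 r)) : f w = g w := by
  have hr0 : 0 < r := one_pos.trans hr
  have hR : 0 < R := (norm_nonneg _).trans_lt (hw 0 (Metric.mem_ball_self hr0))
  have hgd : DifferentiableOn ℂ (fun τ : ℂ => g (τ • w)) (Metric.ball 0 r) := fun τ hτ =>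
    ((hg.differentiableAt (mem_ball_zero_iff.2 (hw τ hτ))).comp τ (f := fun τ : ℂ => τ • w)
      (by fun_prop)).differentiableWithinAt
  have hev : (fun τ : ℂ => f (τ • w)) =ᶠ[𝓝 0] fun τ => g (τ • w) := by
    have hline : Tendsto (fun τ : ℂ => τ • w) (𝓝 0) (𝓝 0) := by
      have hcont : Continuous fun τ : ℂ => τ • w := by fun_prop
      simpa using hcont.tendsto 0
    filter_upwards [hline (Metric.ball_mem_nhds 0 hs), hline (Metric.ball_mem_nhds 0 hR)]
      with τ hτs hτR
    exact (hf _ hτs).unique (hg _ hτR)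
  have heqOn := (hfd.analyticOnNhd Metric.isOpen_ball).eqOn_of_preconnected_of_eventuallyEq
    (hgd.analyticOnNhd Metric.isOpen_ball) (convex_ball (0 : ℂ) r).isPreconnected
    (Metric.mem_ball_self hr0) hev
  simpa using heqOn (show (1 : ℂ) ∈ Metric.ball 0 r by simpa using hr)

theorem exists_one_lt_forall_norm_smul_lt {E : Type*} [SeminormedAddCommGroup E] [NormedSpace ℂ E]
    {v : E} {s : ℝ} (hv : ‖v‖ < s) : ∃ r > 1, ∀ τ ∈ Metric.ball (0 : ℂ) r, ‖τ • v‖ < s := by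
  have hnear : ∀ᶠ r in 𝓝[>] (1 : ℝ), r * ‖v‖ < s := by
    have hcont : Continuous fun r : ℝ => r * ‖v‖ := by fun_prop
    exact nhdsWithin_le_nhds (hcont.tendsto 1 (Iio_mem_nhds (by simpa using hv)))
  obtain ⟨r, hrv, hr⟩ := (hnear.and self_mem_nhdsWithin).exists
  refine ⟨r, hr, fun τ hτ => lt_of_le_of_lt ?_ hrv⟩
  rw [norm_smul]
  gcongr
  exact (mem_ball_zero_iff.1 hτ).le

theorem changeCoord_eq_seriesField {F : (Fin n → ℂ) → Fin n → ℂ}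
    (hF : DifferentiableOn ℂ F (Metric.ball 0 1)) {P : Matrix (Fin n) (Fin n) ℂ} {s : ℝ}
    (hs : 0 < s) {b : Fin n → (Fin n → ℕ) → ℂ}
    (hG : ∀ l, HasMonoSeries s (fun w => changeCoord P F w l) (b l))
    (hsum : ∀ l, ∑' η, ‖b l η‖ₑ ≠ ⊤) {w : Fin n → ℂ} (hw : ‖w‖ < 1) (hPw : ‖P.mulVec w‖ < 1) :
    changeCoord P F w = seriesField b w := by
  obtain ⟨r₁, hr₁, hw₁⟩ := exists_one_lt_forall_norm_smul_lt hw
  obtain ⟨r₂, hr₂, hw₂⟩ := exists_one_lt_forall_norm_smul_lt hPw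
  have hline : DifferentiableOn ℂ (fun τ : ℂ => changeCoord P F (τ • w))
      (Metric.ball 0 (min r₁ r₂)) := by
    have hPline : DifferentiableOn ℂ (fun τ : ℂ => P.mulVec (τ • w))
        (Metric.ball 0 (min r₁ r₂)) := by
      simp_rw [Matrix.mulVec_smul]
      fun_prop
    refine (Matrix.toLin' P⁻¹).toContinuousLinearMap.differentiable.comp_differentiableOn
      (hF.comp hPline fun τ hτ => ?_)
    rw [Matrix.mulVec_smul, mem_ball_zero_iff]
    exact hw₂ τ (Metric.ball_subset_ball (min_le_right _ _) hτ)
  funext l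
  exact (hG l).eq_of_differentiableOn hs (hasMonoSeries_seriesField hsum l) (lt_min hr₁ hr₂)
    (fun τ hτ => hw₁ τ (Metric.ball_subset_ball (min_le_left _ _) hτ))
    (differentiableOn_pi.1 hline l)

/-! ### The weights of the Lyapunov function -/

section Koopman

variable {G : (Fin n → ℂ) → Fin n → ℂ} {s : ℝ} {b : Fin n → (Fin n → ℕ) → ℂ}

theorem koopmanRowSum_eq (hs : 0 < s) (hG : ∀ l, HasMonoSeries s (fun w => G w l) (b l))
    (hb : ∀ l, b l 0 = 0) (β : Fin n → ℕ) : koopmanRowSum G β = ∑' γ, ‖koopmanCoeff b β γ‖ₑ := by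
  simp_rw [koopmanRowSum, koopmanEntry_eq hs hG]
  refine tsum_subtype_eq_of_support_subset (s := {γ | γ ≠ 0})
    (f := fun γ => ‖koopmanCoeff b β γ‖ₑ) fun γ hγ hγ0 => ?_
  rw [Function.mem_support, enorm_ne_zero] at hγ
  have hdeg := deg_le_of_koopmanCoeff_ne_zero hb hγ
  rw [hγ0, deg_eq_zero.2 rfl, Nat.le_zero, deg_eq_zero] at hdeg
  exact hγ (hdeg ▸ koopmanCoeff_zero_left b γ)

theorem koopmanColSum_eq (hs : 0 < s) (hG : ∀ l, HasMonoSeries s (fun w => G w l) (b l))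
    (γ : Fin n → ℕ) : koopmanColSum G γ = ∑' β, ‖koopmanCoeff b β γ‖ₑ := by
  simp_rw [koopmanColSum, koopmanEntry_eq hs hG]
  refine tsum_subtype_eq_of_support_subset (s := {β | β ≠ 0})
    (f := fun β => ‖koopmanCoeff b β γ‖ₑ) fun β hβ hβ0 => ?_
  exact enorm_ne_zero.1 hβ (hβ0 ▸ koopmanCoeff_zero_left b γ)

theorem exists_koopmanRatio_lt {κ : ℝ} {q : ℝ≥0∞} (h : koopmanLimsup κ G < q) :
    ∃ k₀ : ℕ, ∀ β γ : Fin n → ℕ, k₀ < deg γ → β ≠ 0 → deg β < deg γ → koopmanEntry G β γ ≠ 0 →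
      koopmanRatio κ G β γ < q := by
  have hev := eventually_lt_of_limsup_lt h
  rw [eventually_cofinite] at hev
  obtain ⟨k₀, hk₀⟩ := (hev.image deg).bddAbove
  refine ⟨k₀, fun β γ hγ hβ hlt hne => ?_⟩
  have hsup := not_not.1 fun hc => hγ.not_ge (hk₀ (mem_image_of_mem deg hc))
  refine lt_of_le_of_lt ?_ hsup
  exact le_iSup_of_le β (le_iSup_of_le hβ (le_iSup_of_le (Or.inl hlt) (le_iSup_of_le hne le_rfl)))

-- A component with infinitely many coefficients has some of high degree in row `Pi.single l 1`,
-- where the finite quotient bounds the absolute sum of the row, i.e. of all coefficients.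
theorem tsum_enorm_coeff_ne_top (hs : 0 < s) (hG : ∀ l, HasMonoSeries s (fun w => G w l) (b l))
    (hb : ∀ l, b l 0 = 0) {κ : ℝ} {q : ℝ≥0∞}
    (hlim : koopmanLimsup κ G < q) (l : Fin n) : ∑' η, ‖b l η‖ₑ ≠ ⊤ := by
  obtain ⟨k₀, hk₀⟩ := exists_koopmanRatio_lt hlim
  by_cases hsupp : ∀ γ, b l γ ≠ 0 → deg γ ≤ max k₀ 1
  · rw [tsum_eq_sum (s := (finite_deg_le (n := n) (max k₀ 1)).toFinset)]
    · exact ENNReal.sum_ne_top.2 fun _ _ => enorm_ne_top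
    · intro γ hγ
      by_contra hne
      exact hγ (by simpa using hsupp γ (enorm_ne_zero.1 hne))
  · push Not at hsupp
    obtain ⟨γ, hγ, hdeg⟩ := hsupp
    have hne : koopmanCoeff b (Pi.single l 1) γ ≠ 0 := by rwa [koopmanCoeff_single]
    have hratio := hk₀ (Pi.single l 1) γ ((le_max_left _ _).trans_lt hdeg) (by simp)
      (by rw [deg_single]; exact (le_max_right _ _).trans_lt hdeg)
      (by rwa [koopmanEntry_eq hs hG])
    have hrow : koopmanRowSum G (Pi.single l 1) = ∑' η, ‖b l η‖ₑ := by
      simp_rw [koopmanRowSum_eq hs hG hb, koopmanCoeff_single]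
    have hcol : koopmanColSum G γ ≠ 0 := by
      rw [koopmanColSum_eq hs hG]
      exact fun h0 => enorm_ne_zero.2 hne (ENNReal.tsum_eq_zero.1 h0 _)
    intro htop
    rw [koopmanRatio, hrow, htop, ENNReal.mul_top hcol,
      ENNReal.top_div_of_ne_top ENNReal.ofReal_ne_top] at hratio
    exact not_top_lt hratio

theorem abs_re_koopmanEntry_self (hs : 0 < s)
    (hG : ∀ l, HasMonoSeries s (fun w => G w l) (b l)) {d : Fin n → ℝ≥0}
    (hd : ∀ l, (linearPart b l l).re = -(d l : ℝ)) (β : Fin n → ℕ) :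
    |(koopmanEntry G β β).re| = diagWeight d β := by
  have hterm (l : Fin n) : ((β l : ℂ) * b l (Pi.single l 1)).re = -((β l * d l : ℝ≥0) : ℝ) := by
    rw [show b l (Pi.single l 1) = linearPart b l l from rfl, ← Complex.ofReal_natCast,
      Complex.re_ofReal_mul, hd]
    simp
  rw [koopmanEntry_eq hs hG, koopmanCoeff_self, Complex.re_sum]
  simp_rw [hterm]
  rw [Finset.sum_neg_distrib, abs_neg, ← NNReal.coe_sum, NNReal.abs_eq, diagWeight]

theorem exists_koopmanRow_mul_koopmanCol_le (hs : 0 < s)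
    (hG : ∀ l, HasMonoSeries s (fun w => G w l) (b l)) (hb : ∀ l, b l 0 = 0) {d : Fin n → ℝ≥0}
    (hd : ∀ l, (linearPart b l l).re = -(d l : ℝ)) (hd0 : ∀ l, 0 < d l) {κ q : ℝ≥0} (hκ : 0 < κ)
    (hlim : koopmanLimsup κ G < q) :
    ∃ k₀, ∀ β γ, k₀ < deg γ → β ≠ 0 → deg β < deg γ → koopmanCoeff b β γ ≠ 0 →
      koopmanRow b β * koopmanCol b γ ≤ κ ^ 2 * (diagWeight d β * diagWeight d γ) * q := by
  have hsum := tsum_enorm_coeff_ne_top hs hG hb hlim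
  obtain ⟨k₀, hk₀⟩ := exists_koopmanRatio_lt hlim
  refine ⟨k₀, fun β γ hγ hβ hlt hne => ?_⟩
  have hγ0 : γ ≠ 0 := fun h0 => by simp [h0, deg] at hlt
  have hdenom : κ ^ 2 * diagWeight d γ * diagWeight d β ≠ 0 :=
    (mul_pos (mul_pos (pow_pos hκ 2) (diagWeight_pos hd0 hγ0)) (diagWeight_pos hd0 hβ)).ne'
  have hcast : ENNReal.ofReal ((κ : ℝ) ^ 2 * diagWeight d γ * diagWeight d β) =
      ((κ ^ 2 * diagWeight d γ * diagWeight d β : ℝ≥0) : ℝ≥0∞) := by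
    rw [← ENNReal.ofReal_coe_nnreal]
    push_cast
    rfl
  have hratio := hk₀ β γ hγ hβ hlt (by rwa [koopmanEntry_eq hs hG])
  rw [koopmanRatio, abs_re_koopmanEntry_self hs hG hd, abs_re_koopmanEntry_self hs hG hd,
    koopmanColSum_eq hs hG, koopmanRowSum_eq hs hG hb, ← coe_koopmanRow hsum,
    ← coe_koopmanCol hb, hcast, ← ENNReal.coe_mul, ← ENNReal.coe_div hdenom, ENNReal.coe_lt_coe,
    div_lt_iff₀ (pos_iff_ne_zero.2 hdenom)] at hratio
  calc koopmanRow b β * koopmanCol b γ = koopmanCol b γ * koopmanRow b β := mul_comm _ _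
    _ ≤ q * (κ ^ 2 * diagWeight d γ * diagWeight d β) := hratio.le
    _ = κ ^ 2 * (diagWeight d β * diagWeight d γ) * q := by ring

end Koopman

/-- The weights of the Lyapunov function: geometric with ratio `q`, except that the ratio is `A * q`
in the finitely many degrees up to `k₁`, which the condition on the limit superior leaves free. -/
def lyapunovWeight (A q : ℝ≥0) (k₁ k : ℕ) : ℝ≥0 :=
  if k = 0 then 0 else A ^ min k k₁ * q ^ k

section LyapunovWeight

variable {A q : ℝ≥0} {k₁ : ℕ}

theorem lyapunovWeight_of_pos {k : ℕ} (hk : 0 < k) :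
    lyapunovWeight A q k₁ k = A ^ min k k₁ * q ^ k :=
  if_neg hk.ne'

theorem isLyapunovWeight_lyapunovWeight {ρ : ℝ≥0} (hρ : 0 < ρ) (hA : 1 ≤ A) (k₁ : ℕ) :
    IsLyapunovWeight ρ (lyapunovWeight A (ρ ^ 2)⁻¹ k₁) where
  zero := if_pos rfl
  one_pos := by
    rw [lyapunovWeight_of_pos one_pos]
    exact mul_pos (pow_pos (zero_lt_one.trans_le hA) _) (by positivity)
  exists_le := by
    refine ⟨A ^ k₁, fun k => ?_⟩
    rw [lyapunovWeight]
    split_ifs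
    · exact zero_le
    · gcongr
      exact min_le_right _ _

theorem lyapunovWeight_mul_left_le (hA : 1 ≤ A) (hq : 1 ≤ q) {j k : ℕ} (hj : 0 < j) (hjk : j < k)
    (hk : k ≤ k₁) : lyapunovWeight A q k₁ j * A ≤ lyapunovWeight A q k₁ k := by
  rw [lyapunovWeight_of_pos hj, lyapunovWeight_of_pos (hj.trans hjk), min_eq_left hk,
    min_eq_left (hjk.le.trans hk)]
  calc A ^ j * q ^ j * A = A ^ (j + 1) * q ^ j := by ring
    _ ≤ A ^ k * q ^ k := by gcongr; exact hjk

theorem lyapunovWeight_mul_right_le (hA : 1 ≤ A) (hq : 1 ≤ q) {j k : ℕ} (hj : 0 < j)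
    (hjk : j < k) : lyapunovWeight A q k₁ j * q ≤ lyapunovWeight A q k₁ k := by
  rw [lyapunovWeight_of_pos hj, lyapunovWeight_of_pos (hj.trans hjk)]
  calc A ^ min j k₁ * q ^ j * q = A ^ min j k₁ * q ^ (j + 1) := by ring
    _ ≤ A ^ min k k₁ * q ^ k := by gcongr; exact hjk

end LyapunovWeight

theorem isSchurWeight_lyapunovWeight {b : Fin n → (Fin n → ℕ) → ℂ} {d : Fin n → ℝ≥0}
    {κ A q : ℝ≥0} {k₁ : ℕ} (hA : 1 ≤ A) (hq : 1 ≤ q)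
    (hlow : ∀ β γ, β ≠ 0 → deg β < deg γ → deg γ ≤ k₁ →
      koopmanRow b β * koopmanCol b γ ≤ κ ^ 2 * (diagWeight d β * diagWeight d γ) * A)
    (hhigh : ∀ β γ, k₁ < deg γ → β ≠ 0 → deg β < deg γ → koopmanCoeff b β γ ≠ 0 →
      koopmanRow b β * koopmanCol b γ ≤ κ ^ 2 * (diagWeight d β * diagWeight d γ) * q) :
    IsSchurWeight b d κ (lyapunovWeight A q k₁) := by
  intro β γ hlt hne
  have hβ : β ≠ 0 := fun h0 => hne (h0 ▸ koopmanCoeff_zero_left b γ)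
  have hdeg : 0 < deg β := Nat.pos_of_ne_zero fun h0 => hβ (deg_eq_zero.1 h0)
  obtain ⟨a, hle, hweight⟩ : ∃ a,
      koopmanRow b β * koopmanCol b γ ≤ κ ^ 2 * (diagWeight d β * diagWeight d γ) * a ∧
      lyapunovWeight A q k₁ (deg β) * a ≤ lyapunovWeight A q k₁ (deg γ) := by
    rcases le_or_gt (deg γ) k₁ with hγ | hγ
    · exact ⟨A, hlow β γ hβ hlt hγ, lyapunovWeight_mul_left_le hA hq hdeg hlt hγ⟩
    · exact ⟨q, hhigh β γ hγ hβ hlt hne, lyapunovWeight_mul_right_le hA hq hdeg hlt⟩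
  calc lyapunovWeight A q k₁ (deg β) * (koopmanRow b β * koopmanCol b γ)
      ≤ lyapunovWeight A q k₁ (deg β) * (κ ^ 2 * (diagWeight d β * diagWeight d γ) * a) :=
        mul_le_mul_of_nonneg_left hle zero_le
    _ = κ ^ 2 * (diagWeight d β * diagWeight d γ) * (lyapunovWeight A q k₁ (deg β) * a) := by ring
    _ ≤ κ ^ 2 * (diagWeight d β * diagWeight d γ) * lyapunovWeight A q k₁ (deg γ) :=
        mul_le_mul_of_nonneg_left hweight zero_le

section Family

variable {ι : Type*} [Finite ι] {b : ι → Fin n → (Fin n → ℕ) → ℂ} {d : ι → Fin n → ℝ≥0} {κ : ℝ≥0}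

theorem exists_koopmanRow_mul_koopmanCol_le_of_deg_le (hd : ∀ i l, 0 < d i l) (hκ : 0 < κ)
    (k₁ : ℕ) : ∃ A : ℝ≥0, 1 ≤ A ∧ ∀ i β γ, β ≠ 0 → deg β < deg γ → deg γ ≤ k₁ →
      koopmanRow (b i) β * koopmanCol (b i) γ ≤
        κ ^ 2 * (diagWeight (d i) β * diagWeight (d i) γ) * A := by
  obtain ⟨A, hA⟩ := ((finite_univ (α := ι)).prod
    ((finite_deg_le (n := n) k₁).prod (finite_deg_le k₁))).image (fun p =>
      koopmanRow (b p.1) p.2.1 * koopmanCol (b p.1) p.2.2 /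
        (κ ^ 2 * (diagWeight (d p.1) p.2.1 * diagWeight (d p.1) p.2.2))) |>.bddAbove
  refine ⟨max 1 A, le_max_left _ _, fun i β γ hβ hlt hγ => ?_⟩
  have hγ0 : γ ≠ 0 := fun h0 => by simp [h0, deg] at hlt
  have hquot := (hA (mem_image_of_mem _
    (show (i, β, γ) ∈ _ from ⟨mem_univ _, hlt.le.trans hγ, hγ⟩))).trans (le_max_right 1 A)
  rwa [div_le_iff₀' (mul_pos (pow_pos hκ 2)
    (mul_pos (diagWeight_pos (hd i) hβ) (diagWeight_pos (hd i) hγ0)))] at hquot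

theorem exists_isLyapunovWeight_isSchurWeight {ρ : ℝ≥0} (hρ : 0 < ρ) (hρ1 : ρ ≤ 1)
    (hd : ∀ i l, 0 < d i l) (hκ : 0 < κ)
    (h : ∀ i, ∃ k₀, ∀ β γ, k₀ < deg γ → β ≠ 0 → deg β < deg γ → koopmanCoeff (b i) β γ ≠ 0 →
      koopmanRow (b i) β * koopmanCol (b i) γ ≤
        κ ^ 2 * (diagWeight (d i) β * diagWeight (d i) γ) * (ρ ^ 2)⁻¹) :
    ∃ ε, IsLyapunovWeight ρ ε ∧ ∀ i, IsSchurWeight (b i) (d i) κ ε := by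
  choose k₀ hk₀ using h
  obtain ⟨k₁, hk₁⟩ := Finite.exists_le k₀
  obtain ⟨A, hA1, hA⟩ := exists_koopmanRow_mul_koopmanCol_le_of_deg_le (b := b) hd hκ k₁
  have hq : 1 ≤ (ρ ^ 2)⁻¹ := (one_le_inv₀ (pow_pos hρ 2)).2 (pow_le_one₀ zero_le hρ1)
  exact ⟨_, isLyapunovWeight_lyapunovWeight hρ hA1 k₁, fun i =>
    isSchurWeight_lyapunovWeight hA1 hq (hA i) fun β γ hγ => hk₀ i β γ ((hk₁ i).trans_lt hγ)⟩

end Family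

/-! ### Decay of the Lyapunov function along trajectories -/

section Decay

variable {m : ℕ} {F : Fin m → (Fin n → ℂ) → Fin n → ℂ} {X : Set (Fin n → ℂ)}
  {P : Matrix (Fin n) (Fin n) ℂ} {ρ : ℝ≥0} {ε : ℕ → ℝ≥0} {c : ℝ}

theorem norm_mulVec_le_of_infNorm_le_one {A : Matrix (Fin n) (Fin n) ℂ} (hA : infNorm A ≤ 1)
    (v : Fin n → ℂ) : ‖A.mulVec v‖ ≤ ‖v‖ :=
  (norm_mulVec_le A v).trans (mul_le_of_le_one_left (norm_nonneg v) (mod_cast hA))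

theorem IsTrajectory.lyapunov_le_mul_exp {σ : ℝ → Fin m} {x : ℝ → Fin n → ℂ}
    (hF : ∀ i, ContinuousOn (F i) X) (hσ : IsCommutationLaw σ) (hx : IsTrajectory F X σ x)
    (hP : infNorm P⁻¹ ≤ 1) (hε : IsLyapunovWeight ρ ε)
    (hdecay : ∀ i z, ‖z‖ < ρ →
      lyapunovDeriv ε (P⁻¹.mulVec z) (P⁻¹.mulVec (F i z)) ≤ -c * lyapunov ε (P⁻¹.mulVec z))
    (hxρ : ∀ t, 0 ≤ t → ‖x t‖ < ρ) {t : ℝ} (ht : 0 ≤ t) :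
    lyapunov ε (P⁻¹.mulVec (x t)) ≤ lyapunov ε (P⁻¹.mulVec (x 0)) * Real.exp (-c * t) := by
  set A := (Matrix.toLin' P⁻¹).toContinuousLinearMap
  have hAρ : ∀ s, 0 ≤ s → ‖A (x s)‖ < ρ := fun s hs =>
    (norm_mulVec_le_of_infNorm_le_one hP (x s)).trans_lt (hxρ s hs)
  refine le_mul_exp_of_hasDerivWithinAt (V := fun s => lyapunov ε (A (x s)))
    (fun s hs => ?_) (fun s hs => ?_) ht
  · exact (hε.continuousAt_lyapunov (hAρ s hs)).comp_continuousWithinAt (f := fun s => A (x s))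
      (A.continuous.continuousAt.comp_continuousWithinAt (f := x) (hx.continuousOn s hs))
  · obtain ⟨b, hb, i, hi⟩ := hσ.exists_right hs
    have hderiv : HasDerivWithinAt (fun s => A (x s)) (A (F i (x s))) (Ici s) s :=
      (A.restrictScalars ℝ).hasFDerivAt.comp_hasDerivWithinAt s
        (hx.hasDerivWithinAt_Ici hF hs hb hi)
    exact ⟨_, hε.hasDerivWithinAt_lyapunov hderiv (hAρ s hs), hdecay i (x s) (hxρ s hs)⟩

theorem div_mul_sq_norm_le_lyapunov_mulVec_inv (hP : IsUnit P.det) (hε : IsLyapunovWeight ρ ε)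
    {z : Fin n → ℂ} (hz : ‖P⁻¹.mulVec z‖ < ρ) :
    ε 1 / (infNorm P + 1) ^ 2 * ‖z‖ ^ 2 ≤ lyapunov ε (P⁻¹.mulVec z) := by
  have hnorm : ‖z‖ ≤ (infNorm P + 1) * ‖P⁻¹.mulVec z‖ :=
    calc ‖z‖ = ‖P.mulVec (P⁻¹.mulVec z)‖ := by
          rw [Matrix.mulVec_mulVec, Matrix.mul_nonsing_inv P hP, Matrix.one_mulVec]
      _ ≤ infNorm P * ‖P⁻¹.mulVec z‖ := norm_mulVec_le P _
      _ ≤ (infNorm P + 1) * ‖P⁻¹.mulVec z‖ := by gcongr; linarith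
  calc ε 1 / ((infNorm P : ℝ) + 1) ^ 2 * ‖z‖ ^ 2
      ≤ ε 1 / ((infNorm P : ℝ) + 1) ^ 2 * ((infNorm P + 1) * ‖P⁻¹.mulVec z‖) ^ 2 := by gcongr
    _ = ε 1 * ‖P⁻¹.mulVec z‖ ^ 2 := by field_simp
    _ ≤ lyapunov ε (P⁻¹.mulVec z) := hε.mul_sq_norm_le_lyapunov hz

theorem isGUAS_of_lyapunovDeriv_le {φ : Fin m → ℝ → (Fin n → ℂ) → Fin n → ℂ}
    (hF : ∀ i, LocallyLipschitzOn X (F i)) (hF0 : ∀ i, F i 0 = 0)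
    (hφ : ∀ i, IsHolomorphicFlow (F i) X (φ i)) (hρ : 0 < ρ)
    (hinv : ∀ i, IsForwardInvariant (φ i) (Metric.ball 0 (ρ : ℝ))) (hP : IsUnit P.det)
    (hPnorm : infNorm P⁻¹ ≤ 1) (hε : IsLyapunovWeight ρ ε) (hc : 0 < c)
    (hdecay : ∀ i z, ‖z‖ < ρ →
      lyapunovDeriv ε (P⁻¹.mulVec z) (P⁻¹.mulVec (F i z)) ≤ -c * lyapunov ε (P⁻¹.mulVec z)) :
    IsGUAS F X 0 (Metric.ball 0 (ρ : ℝ)) := by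
  have hPρ : ∀ {z : Fin n → ℂ}, ‖z‖ < ρ → ‖P⁻¹.mulVec z‖ < ρ :=
    (norm_mulVec_le_of_infNorm_le_one hPnorm _).trans_lt
  refine isGUAS_of_lyapunov (V := fun z => lyapunov ε (P⁻¹.mulVec z))
    (e := ε 1 / (infNorm P + 1) ^ 2) (Metric.ball_mem_nhds 0 (mod_cast hρ)) hF0
    (div_pos (mod_cast hε.one_pos) (by positivity)) hc ?_ ?_ fun σ x hσ hx h0 t ht => ?_
  · simp only [Matrix.mulVec_zero, hε.lyapunov_zero hρ]
  · exact (hε.continuousAt_lyapunov (hPρ (by simpa using hρ))).comp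
      (Matrix.toLin' P⁻¹).toContinuousLinearMap.continuous.continuousAt
  · have hxρ : ∀ s, 0 ≤ s → ‖x s‖ < ρ := fun s hs => mem_ball_zero_iff.1
      (hx.mem_of_isForwardInvariant hF hσ hφ Metric.isOpen_ball hinv h0 hs)
    exact (div_mul_sq_norm_le_lyapunov_mulVec_inv hP hε (hPρ (hxρ t ht))).trans
      (hx.lyapunov_le_mul_exp (fun i => (hF i).continuousOn) hσ hPnorm hε hdecay hxρ ht)

end Decay

theorem lyapunovDeriv_le_neg_mul_lyapunov {G : (Fin n → ℂ) → Fin n → ℂ}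
    {b : Fin n → (Fin n → ℕ) → ℂ} {d : Fin n → ℝ≥0} {θ κ ρ c₀ : ℝ≥0} {ε : ℕ → ℝ≥0}
    (hb : ∀ l, b l 0 = 0) (hsum : ∀ l, ∑' η, ‖b l η‖ₑ ≠ ⊤)
    (hG : ∀ l, HasMonoSeries ρ (fun w => G w l) (b l))
    (hT : IsDiagDominated (linearPart b) d θ) (hschur : IsSchurWeight b d κ ε)
    (hε : IsLyapunovWeight ρ ε) (hθκ : n.choose 2 * θ + κ ≤ 1) (hc₀ : ∀ l, c₀ ≤ d l)
    {w : Fin n → ℂ} (hw : ‖w‖ < ρ) :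
    lyapunovDeriv ε w (G w) ≤ -(2 * (1 - (n.choose 2 * θ + κ)) * c₀) * lyapunov ε w := by
  have hgap : 0 ≤ 2 * (1 - (n.choose 2 * θ + κ) : ℝ) :=
    mul_nonneg zero_le_two (sub_nonneg.2 (mod_cast hθκ))
  calc lyapunovDeriv ε w (G w)
      ≤ 2 * (-1 + (n.choose 2 * θ + κ)) * dissipation ε d w :=
        lyapunovDeriv_le hb hsum hG hT hschur hε hw
    _ = -(2 * (1 - (n.choose 2 * θ + κ)) * dissipation ε d w) := by ring
    _ ≤ -(2 * (1 - (n.choose 2 * θ + κ)) * (c₀ * lyapunov ε w)) :=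
        neg_le_neg (mul_le_mul_of_nonneg_left (hε.mul_lyapunov_le_dissipation hw hc₀) hgap)
    _ = -(2 * (1 - (n.choose 2 * θ + κ)) * c₀) * lyapunov ε w := by ring

theorem two_mul_div_sq_sub_self (n : ℕ) (ξ : ℝ) :
    2 * ξ / ((n : ℝ) ^ 2 - n) = ξ / n.choose 2 := by
  rw [Nat.cast_choose_two, div_div_eq_mul_div, mul_comm 2 ξ]
  ring_nf

theorem isDiagDominated_of_norm_le {T : Matrix (Fin n) (Fin n) ℂ} (hT : T.BlockTriangular id)
    (hneg : ∀ l, (T l l).re ≤ 0) {θ : ℝ≥0}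
    (h₁ : ∀ q r, q < r → ‖T q r‖ ^ 2 ≤ θ ^ 2 * |(T r r).re| * |(T q q).re|)
    (h₂ : ∀ q r, q < r → ‖T q r‖ ≤ θ * |(T q q).re|) :
    IsDiagDominated T (fun l => ‖(T l l).re‖₊) θ where
  blockTriangular := hT
  re_diag l := by rw [coe_nnnorm, Real.norm_of_nonpos (hneg l), neg_neg]
  sq_nnnorm_le q r hqr := by
    rw [mul_comm ‖(T q q).re‖₊, ← mul_assoc]
    exact h₁ q r hqr
  nnnorm_le := h₂

/-- In the coordinates `w = P⁻¹ z` the vector field `F` vanishes at `0`, has the absolutely summable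
Taylor coefficients `b`, and its linear part is dominated with constant `θ` by its diagonal, whose
real parts are the negative numbers `-d l`. -/
structure HasDominatedSeries (P : Matrix (Fin n) (Fin n) ℂ) (F : (Fin n → ℂ) → Fin n → ℂ)
    (b : Fin n → (Fin n → ℕ) → ℂ) (d : Fin n → ℝ≥0) (θ : ℝ≥0) : Prop where
  coeff_zero : ∀ l, b l 0 = 0
  tsum_ne_top : ∀ l, ∑' η, ‖b l η‖ₑ ≠ ⊤
  changeCoord_eq : ∀ w, ‖w‖ < 1 → ‖P.mulVec w‖ < 1 → changeCoord P F w = seriesField b w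
  isDiagDominated : IsDiagDominated (linearPart b) d θ
  pos : ∀ l, 0 < d l

theorem HasSummableTaylor.exists_hasMonoSeries {f : (Fin n → ℂ) → ℂ} (hf : HasSummableTaylor f) :
    ∃ a, HasMonoSeries 1 f a := by
  obtain ⟨a, -, ha⟩ := hf
  rw [polydisk_eq_ball one_pos] at ha
  exact ⟨a, ha⟩

theorem IsHyperbolicStableAtZero.exists_hasDominatedSeries {F : (Fin n → ℂ) → Fin n → ℂ}
    (hF0 : IsHyperbolicStableAtZero F) (hF : ∀ l, HasSummableTaylor fun z => F z l)
    {P : Matrix (Fin n) (Fin n) ℂ} (hP : IsUnit P.det)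
    (htri : (P⁻¹ * jacobian F 0 * P).BlockTriangular id) {θ κ q : ℝ≥0} (hκ : 0 < κ)
    (h₁ : ∀ q r, q < r → ‖jacobian (changeCoord P F) 0 q r‖ ^ 2 ≤ θ ^ 2 *
      |(jacobian (changeCoord P F) 0 r r).re| * |(jacobian (changeCoord P F) 0 q q).re|)
    (h₂ : ∀ q r, q < r → ‖jacobian (changeCoord P F) 0 q r‖ ≤
      θ * |(jacobian (changeCoord P F) 0 q q).re|)
    (hlim : koopmanLimsup κ (changeCoord P F) < q) :
    ∃ b d, HasDominatedSeries P F b d θ ∧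
      ∃ k₀, ∀ β γ, k₀ < deg γ → β ≠ 0 → deg β < deg γ → koopmanCoeff b β γ ≠ 0 →
        koopmanRow b β * koopmanCol b γ ≤ κ ^ 2 * (diagWeight d β * diagWeight d γ) * q := by
  obtain ⟨s, hs, b, hG⟩ := exists_hasMonoSeries_changeCoord hF P
  have hdiff : DifferentiableOn ℂ F (Metric.ball 0 1) := differentiableOn_pi.2 fun l z hz =>
    have ⟨_, ha⟩ := (hF l).exists_hasMonoSeries
    (ha.differentiableAt hz).differentiableWithinAt
  have hJ : linearPart b = P⁻¹ * jacobian F 0 * P := (linearPart_eq_jacobian hs hG).trans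
    (jacobian_changeCoord (hdiff.differentiableAt (Metric.ball_mem_nhds 0 one_pos)) P)
  have hb : ∀ l, b l 0 = 0 := fun l =>
    ((hG l).apply_zero hs).symm.trans (congrFun (changeCoord_zero hF0.1 P) l)
  have hneg : ∀ l, (linearPart b l l).re < 0 :=
    hJ ▸ hF0.re_inv_mul_jacobian_mul_apply_self_neg hP htri
  rw [← linearPart_eq_jacobian hs hG] at h₁ h₂
  have hT := isDiagDominated_of_norm_le (hJ ▸ htri) (fun l => (hneg l).le) h₁ h₂
  have hd : ∀ l, 0 < ‖(linearPart b l l).re‖₊ := fun l => nnnorm_pos.2 (hneg l).ne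
  have hsum := tsum_enorm_coeff_ne_top hs hG hb hlim
  exact ⟨b, _, ⟨hb, hsum, fun w => changeCoord_eq_seriesField hdiff hs hG hsum, hT, hd⟩,
    exists_koopmanRow_mul_koopmanCol_le hs hG hb hT.re_diag hd hκ hlim⟩

theorem isGUAS_of_hasDominatedSeries {m : ℕ} {F : Fin m → (Fin n → ℂ) → Fin n → ℂ}
    {φ : Fin m → ℝ → (Fin n → ℂ) → Fin n → ℂ} {P : Matrix (Fin n) (Fin n) ℂ}
    {b : Fin m → Fin n → (Fin n → ℕ) → ℂ} {d : Fin m → Fin n → ℝ≥0} {θ κ ρ : ℝ≥0} {ε : ℕ → ℝ≥0}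
    (hF : ∀ i, LocallyLipschitzOn (Metric.ball 0 1) (F i)) (hF0 : ∀ i, F i 0 = 0)
    (hφ : ∀ i, IsHolomorphicFlow (F i) (Metric.ball 0 1) (φ i)) (hρ : 0 < ρ) (hρ1 : ρ ≤ 1)
    (hinv : ∀ i, IsForwardInvariant (φ i) (Metric.ball 0 (ρ : ℝ))) (hP : IsUnit P.det)
    (hPnorm : infNorm P⁻¹ ≤ 1) (hb : ∀ i, HasDominatedSeries P (F i) (b i) (d i) θ)
    (hθκ : n.choose 2 * θ + κ < 1) (hε : IsLyapunovWeight ρ ε)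
    (hschur : ∀ i, IsSchurWeight (b i) (d i) κ ε) :
    IsGUAS F (Metric.ball 0 1) 0 (Metric.ball 0 (ρ : ℝ)) := by
  obtain ⟨c₀, hc₀, hle⟩ := exists_pos_forall_le (f := fun p : Fin m × Fin n => d p.1 p.2)
    fun p => (hb p.1).pos p.2
  have hgap : (0 : ℝ) < 1 - (n.choose 2 * θ + κ) := sub_pos.2 (mod_cast hθκ)
  have hρ1' : (ρ : ℝ) ≤ 1 := mod_cast hρ1
  refine isGUAS_of_lyapunovDeriv_le hF hF0 hφ hρ hinv hP hPnorm hε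
    (c := 2 * (1 - (n.choose 2 * θ + κ)) * c₀) (by positivity) fun i z hz => ?_
  have hPP : P.mulVec (P⁻¹.mulVec z) = z := by
    rw [Matrix.mulVec_mulVec, Matrix.mul_nonsing_inv P hP, Matrix.one_mulVec]
  have hw : ‖P⁻¹.mulVec z‖ < ρ := (norm_mulVec_le_of_infNorm_le_one hPnorm z).trans_lt hz
  have hfield : P⁻¹.mulVec (F i z) = seriesField (b i) (P⁻¹.mulVec z) := by
    rw [← (hb i).changeCoord_eq _ (hw.trans_le hρ1') (by rw [hPP]; exact hz.trans_le hρ1'),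
      changeCoord, hPP]
  rw [hfield]
  exact lyapunovDeriv_le_neg_mul_lyapunov (hb i).coeff_zero (hb i).tsum_ne_top
    (fun l => (hasMonoSeries_seriesField (hb i).tsum_ne_top l).of_le hρ1') (hb i).isDiagDominated
    (hschur i) hε hθκ.le (fun l => hle (i, l)) hw

end SwitchedKoopman

theorem mainTheorem3_general {n m : ℕ}
    (F : Fin m → (Fin n → ℂ) → (Fin n → ℂ))
    (φ : Fin m → ℝ → (Fin n → ℂ) → (Fin n → ℂ))
    (hF : ∀ i l, HasSummableTaylor (fun z => F i z l))
    (hφ : ∀ i, IsHolomorphicFlow (F i) (polydisk n 1) (φ i))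
    (hhyp : ∀ i, IsHyperbolicStableAtZero (F i))
    (P : Matrix (Fin n) (Fin n) ℂ) (hP : IsUnit P.det) (hPnorm : infNorm P⁻¹ ≤ 1)
    (htri : ∀ i, (P⁻¹ * jacobian (F i) 0 * P).BlockTriangular id)
    (ρ : ℝ) (hρ0 : 0 < ρ) (hρ1 : ρ ≤ 1)
    (hinv : ∀ i, IsForwardInvariant (φ i) (polydisk n ρ))
    (ξ κ : ℝ) (hξ0 : 0 ≤ ξ) (hκ0 : 0 < κ) (hξκ : ξ + κ < 1)
    (hdiag₁ : ∀ i, ∀ q r : Fin n, q < r →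
      ‖jacobian (changeCoord P (F i)) 0 q r‖ ^ 2 ≤
        (2 * ξ / ((n : ℝ) ^ 2 - n)) ^ 2 *
          |(jacobian (changeCoord P (F i)) 0 r r).re| *
          |(jacobian (changeCoord P (F i)) 0 q q).re|)
    (hdiag₂ : ∀ i, ∀ q r : Fin n, q < r →
      ‖jacobian (changeCoord P (F i)) 0 q r‖ ≤
        2 * ξ / ((n : ℝ) ^ 2 - n) * |(jacobian (changeCoord P (F i)) 0 q q).re|)
    (hlim : ∀ i, koopmanLimsup κ (changeCoord P (F i)) < ENNReal.ofReal (1 / ρ ^ 2)) :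
    IsGUAS F (polydisk n 1) 0 (polydisk n ρ) := by
  lift ρ to ℝ≥0 using hρ0.le
  lift ξ to ℝ≥0 using hξ0
  lift κ to ℝ≥0 using hκ0.le
  norm_cast at hρ0 hρ1 hκ0 hξκ
  have hq : ENNReal.ofReal (1 / (ρ : ℝ) ^ 2) = ((ρ ^ 2)⁻¹ : ℝ≥0) := by
    rw [one_div, ← ENNReal.ofReal_coe_nnreal, NNReal.coe_inv, NNReal.coe_pow]
  have hθκ : n.choose 2 * (ξ / n.choose 2) + κ < 1 := by
    refine lt_of_le_of_lt ?_ hξκ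
    rw [mul_div_left_comm]
    gcongr
    exact mul_le_of_le_one_right' (div_self_le_one _)
  simp_rw [two_mul_div_sq_sub_self] at hdiag₁ hdiag₂
  choose b d hb hdom using fun i => (hhyp i).exists_hasDominatedSeries (θ := ξ / n.choose 2) (hF i)
    hP (htri i) hκ0 (hdiag₁ i) (hdiag₂ i) (hq ▸ hlim i)
  obtain ⟨ε, hε, hschur⟩ := exists_isLyapunovWeight_isSchurWeight hρ0 hρ1
    (fun i => (hb i).pos) hκ0 hdom
  rw [polydisk_eq_ball one_pos] at hφ ⊢
  rw [polydisk_eq_ball (NNReal.coe_pos.2 hρ0)] at hinv ⊢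
  choose a ha using fun i l => (hF i l).exists_hasMonoSeries
  exact isGUAS_of_hasDominatedSeries (fun i => HasMonoSeries.locallyLipschitzOn (ha i))
    (fun i => (hhyp i).1) hφ hρ0 hρ1 hinv hP hPnorm hb hθκ hε hschur

theorem mainTheorem3 {n m : ℕ}
    (F : Fin m → (Fin n → ℂ) → (Fin n → ℂ))
    (φ : Fin m → ℝ → (Fin n → ℂ) → (Fin n → ℂ))
    (hF : ∀ i l, HasSummableTaylor (fun z => F i z l))
    (hφ : ∀ i, IsHolomorphicFlow (F i) (polydisk n 1) (φ i))
    (hhyp : ∀ i, IsHyperbolicStableAtZero (F i))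
    (hgas : ∀ i, IsGloballyAsymptoticallyStable (φ i) (polydisk n 1) 0)
    (hsolv : HasSolvableLieSpan (Set.range fun i => jacobian (F i) 0))
    (P : Matrix (Fin n) (Fin n) ℂ) (hP : IsUnit P.det) (hPnorm : infNorm P⁻¹ = 1)
    (htri : ∀ i, (P⁻¹ * jacobian (F i) 0 * P).BlockTriangular id)
    (ρ : ℝ) (hρ0 : 0 < ρ) (hρ1 : ρ ≤ 1)
    (hinv : ∀ i, IsForwardInvariant (φ i) (polydisk n ρ))
    (ξ κ : ℝ) (hξ0 : 0 < ξ) (hξ1 : ξ < 1) (hκ0 : 0 < κ) (hκ1 : κ < 1) (hξκ : ξ + κ < 1)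
    (hdiag₁ : ∀ i, ∀ q r : Fin n, q < r →
      ‖jacobian (changeCoord P (F i)) 0 q r‖ ^ 2 <
        (2 * ξ / ((n : ℝ) ^ 2 - n)) ^ 2 *
          |(jacobian (changeCoord P (F i)) 0 r r).re| *
          |(jacobian (changeCoord P (F i)) 0 q q).re|)
    (hdiag₂ : ∀ i, ∀ q r : Fin n, q < r →
      ‖jacobian (changeCoord P (F i)) 0 q r‖ <
        2 * ξ / ((n : ℝ) ^ 2 - n) * |(jacobian (changeCoord P (F i)) 0 q q).re|)
    (hlim : ∀ i, koopmanLimsup κ (changeCoord P (F i)) < ENNReal.ofReal (1 / ρ ^ 2)) :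
    IsGUAS F (polydisk n 1) 0 (polydisk n ρ) :=
  mainTheorem3_general F φ hF hφ hhyp P hP hPnorm.le htri ρ hρ0 hρ1 hinv ξ κ hξ0.le hκ0 hξκ
    (fun i q r hqr => (hdiag₁ i q r hqr).le) (fun i q r hqr => (hdiag₂ i q r hqr).le) hlim
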